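/- **Theorem 3.2 (Learning $(\zeta,\delta,r)$-clusterable distributions).** *Definitions.* For $X,Y\in\{0,1\}^m$ let $d_H(X,Y)=\frac1m|\{i: X_i\ne Y_i\}|$ (and $d_H=0$ if $m=0$). For distributions $D_1,D_2$ over $\{0,1\}^n$, the Earth Mover Distance $d_{EM}(D_1,D_2)$ is the minimum of $\sum_{X,Y}f_{XY}\,d_H(X,Y)$ over all $f$ with values in $[0,1]$ such that $\sum_Y f_{XY}=D_1(X)$ for all $X$ and $\sum_X f_{XY}=D_2(Y)$ for all $Y$. For a permutation $\sigma$ of $[n]$, $D_\sigma$ is the distribution with $D_\sigma(w_{\sigma(1)},\dots,w_{\sigma(n)})=D(w_1,\dots,w_n)$ for all $w$. A distribution $D$ over $\{0,1\}^n$ is *$(\zeta,\delta,r)$-clusterable* if $\{0,1\}^n$ can be partitioned into (possibly empty) sets $\mathcal C_0,\dots,\mathcal C_s$ with $s\le r$, $D(\mathcal C_0)\le\zeta$, and $d_H(U,V)\le\delta$ for all $U,V\in\mathcal C_i$ and $1\le i\le s$. A *non-adaptive algorithm* with $s$ samples tosses coins, which determine sets $J_1,\dots,J_s\subseteq[n]$;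 it draws $s$ independent samples $V_1,\dots,V_s$ from $D$, queries the coordinates of $V_i$ in $J_i$ for each $i$ (in total $\sum_i|J_i|$ queries), and its output depends only on the coins and on the answers. *Test-and-Learn* with parameters $\zeta,\delta,r$ and constants $c_1,c_2,c_3>0$. Let $t_1=\lceil c_1\frac r\zeta\log\frac r\zeta\rceil$, $t_2=\lceil c_2\frac{t_1^2}{\zeta^2}\log t_1\rceil$ and $k=\lceil c_3\frac{4^{t_1}}{\delta^2\zeta}\log\frac{r}{\delta\zeta}\rceil$. 1. Draw independent samples $X_1,\dots,X_{t_1},Y_1,\dots,Y_{t_2}$ from $D$ and, independently, a uniformly random $R\subseteq[n]$ with $|R|=\min(k,n)$. Query all samples exactly at the indices in $R$, obtaining the restrictions $x_i=X_i|_R$ and $y_j=Y_j|_R$. 2. Assign each $y_j$ to the $x_i$ with the least index $i$ such that $d_H(y_j,x_i)\le2\delta$; if there is none, $y_j$ stays unassigned. If more than $3\zeta t_2$ of the $y_j$ are unassigned, output Fail. Otherwise let $w_i$ be the number of $y_j$ assigned to $x_i$, divided by $t_2$. 3. For $J\in\{0,1\}^{t_1}$ let $\gamma_J$ be the fraction of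 those $i\in R$ with $(x_1(i),\dots,x_{t_1}(i))=J$. Choose integers $\Gamma_J\in\{\lfloor\gamma_Jn\rfloor,\lceil\gamma_Jn\rceil\}$ with $\sum_J\Gamma_J=n$, and let $S_1,\dots,S_{t_1}\in\{0,1\}^n$ be the rows of a $t_1\times n$ matrix in which, for each $J$, exactly $\Gamma_J$ columns equal $J$. 4. Output any distribution $D'$ over $\{0,1\}^n$ that is supported on the set $\{S_1,\dots,S_{t_1}\}$ and satisfies $D'(S_i)\ge w_i$ for all $i$. *Theorem.* There are absolute constants $c_1,c_2,c_3>0$ such that the following holds for all real $\zeta,\delta\in(0,1)$ with $\varepsilon:=17(\delta+\zeta)<1$, all integers $r\ge1$ and all $n\in\mathbb N$. The choices left open in steps 3 and 4 can always be made, and however they are made (as a function of $R$ and of the answers), Test-and-Learn is a non-adaptive algorithm that draws $t_1+t_2$ samples and makes at most $(t_1+t_2)k$ queries, a number that depends only on $\zeta,\delta,r$, and that outputs a distribution over $\{0,1\}^n$ or Fail, such that for every distribution $D$ over $\{0,1\}^n$: (i) if $D$ is $(\zeta,\delta,r)$-clusterable, then with probability at least $\frac23$ it outputs a distribution $D'$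 with $d_{EM}(D,D'_\sigma)\le\varepsilon$ for some permutation $\sigma$ of $[n]$; (ii) for any $D$, clusterable or not, the probability that it outputs a distribution $D'$ with $d_{EM}(D,D'_\sigma)>\varepsilon$ for every permutation $\sigma$ of $[n]$ is at most $\frac13$. (If $D$ is not clusterable, it may output Fail with any probability.) -/

import Mathlib

namespace HugeObject

/-- The Hamming cube `{0,1}^n`. -/
abbrev Cube (n : ℕ) : Type := Fin n → Bool

/-- Probability distributions over a finite type: non-negative weights with sum `1`. -/
abbrev Distr (α : Type) [Fintype α] : Type := stdSimplex ℝ α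

/-- The mass `D(C)` of a set `C`. -/
def mass {α : Type} [Fintype α] (D : Distr α) (C : Finset α) : ℝ := ∑ x ∈ C, D x

/-- The uniform distribution. -/
noncomputable def uniform (α : Type) [Fintype α] [Nonempty α] : Distr α :=
  ⟨fun _ => (Fintype.card α : ℝ)⁻¹, fun _ => by positivity, by simp⟩

/-- The normalized Hamming distance of two vectors indexed by `ι`. -/
noncomputable def dH {ι : Type} [Fintype ι] (x y : ι → Bool) : ℝ :=
  (hammingDist x y : ℝ) / Fintype.card ι

/-- The feasible flows of the linear program that defines the Earth Mover Distance. -/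
def flows {n : ℕ} (D₁ D₂ : Distr (Cube n)) : Set (Cube n → Cube n → ℝ) :=
  {f | (∀ X, ∑ Y, f X Y = D₁ X) ∧ (∀ Y, ∑ X, f X Y = D₂ Y) ∧ ∀ X Y, 0 ≤ f X Y ∧ f X Y ≤ 1}

/-- The Earth Mover Distance with respect to the normalized Hamming distance. -/
noncomputable def dEM {n : ℕ} (D₁ D₂ : Distr (Cube n)) : ℝ :=
  sInf ((fun f => ∑ X, ∑ Y, f X Y * dH X Y) '' flows D₁ D₂)

/-- The linear program is feasible, so that the infimum in `dEM` is over a nonempty set. -/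
theorem flows_nonempty {n : ℕ} (D₁ D₂ : Distr (Cube n)) : (flows D₁ D₂).Nonempty := by
  refine ⟨fun X Y => D₁ X * D₂ Y, fun X => ?_, fun Y => ?_, fun X Y => ⟨?_, ?_⟩⟩
  · rw [← Finset.mul_sum, show ∑ Y, D₂ Y = 1 from D₂.2.2, mul_one]
  · rw [← Finset.sum_mul, show ∑ X, D₁ X = 1 from D₁.2.2, one_mul]
  · exact mul_nonneg (D₁.2.1 X) (D₂.2.1 Y)
  · have h1 : D₁ X ≤ 1 := (mem_Icc_of_mem_stdSimplex D₁.2 X).2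
    have h2 : D₂ Y ≤ 1 := (mem_Icc_of_mem_stdSimplex D₂.2 Y).2
    exact mul_le_one₀ h1 (D₂.2.1 Y) h2

/-- The permuted distribution `D_σ`, determined by
`D_σ (w_{σ(1)}, …, w_{σ(n)}) = D (w_1, …, w_n)`. -/
def permute {n : ℕ} (D : Distr (Cube n)) (σ : Equiv.Perm (Fin n)) : Distr (Cube n) :=
  ⟨fun v => D (v ∘ σ.symm), fun v => D.2.1 _, by
    have h := Equiv.sum_comp (Equiv.arrowCongr σ (Equiv.refl Bool)) (fun v : Cube n => D v)
    exact h.trans D.2.2⟩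

theorem permute_apply {n : ℕ} (D : Distr (Cube n)) (σ : Equiv.Perm (Fin n)) (w : Cube n) :
    permute D σ (fun i => w (σ i)) = D w := by
  change D ((fun i => w (σ i)) ∘ σ.symm) = D w
  congr 1
  funext i
  simp

/-- `D` is `(ζ, δ, r)`-clusterable: the cube is partitioned into `C 0, …, C s` with `s ≤ r`, the
part `C 0` has mass at most `ζ`, and every other part has diameter at most `δ`. -/
def Clusterable {n : ℕ} (ζ δ : ℝ) (r : ℕ) (D : Distr (Cube n)) : Prop :=
  ∃ s ≤ r, ∃ C : Fin (s + 1) → Finset (Cube n),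
    (∀ i j, i ≠ j → Disjoint (C i) (C j)) ∧ (∀ X, ∃ i, X ∈ C i) ∧
    mass D (C 0) ≤ ζ ∧
    ∀ i, i ≠ 0 → ∀ U ∈ C i, ∀ V ∈ C i, dH U V ≤ δ

/-- A non-adaptive algorithm that draws `s` samples over `{0,1}^n`. The random coins alone determine
the set of indices that is queried in each sample, and the output is a function of the coins and
the answers to these queries. -/
structure NonAdaptiveAlgorithm (n s : ℕ) (Out : Type) where
  Coins : Type
  [fintypeCoins : Fintype Coins]
  coinDist : Distr Coins
  queries : Coins → Fin s → Finset (Fin n)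
  output : (c : Coins) → ((i : Fin s) → {j // j ∈ queries c i} → Bool) → Out

attribute [instance] NonAdaptiveAlgorithm.fintypeCoins

/-- The number of queries made when the coins come out as `c`. -/
def NonAdaptiveAlgorithm.queryCount {n s : ℕ} {Out : Type} (A : NonAdaptiveAlgorithm n s Out)
    (c : A.Coins) : ℕ :=
  ∑ i, (A.queries c i).card

open Classical in
/-- The probability, over the coins and `s` independent samples from `D`, that the output of the
algorithm satisfies `E`. -/
noncomputable def NonAdaptiveAlgorithm.prob {n s : ℕ} {Out : Type}
    (A : NonAdaptiveAlgorithm n s Out) (D : Distr (Cube n)) (E : Out → Prop) : ℝ :=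
  ∑ c : A.Coins, ∑ V : Fin s → Cube n,
    if E (A.output c fun i j => V i j) then A.coinDist c * ∏ i, D (V i) else 0

section Algorithm

/-- The sample size `t₁ = O((r/ζ) log (r/ζ))`, with hidden constant `c₁`. -/
noncomputable def sizeS (c₁ ζ : ℝ) (r : ℕ) : ℕ := ⌈c₁ * (r / ζ) * Real.log (r / ζ)⌉₊

/-- The sample size `t₂ = O((t₁²/ζ²) log t₁)`, with hidden constant `c₂`. -/
noncomputable def sizeT (c₂ ζ : ℝ) (t₁ : ℕ) : ℕ :=
  ⌈c₂ * ((t₁ : ℝ) ^ 2 / ζ ^ 2) * Real.log t₁⌉₊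

/-- The size `O((4^{t₁}/(δ²ζ)) log (r/(δζ)))` of the index set `R`, with hidden constant `c₃`. -/
noncomputable def sizeR (c₃ ζ δ : ℝ) (r t₁ : ℕ) : ℕ :=
  ⌈c₃ * ((4 : ℝ) ^ t₁ / (δ ^ 2 * ζ)) * Real.log (r / (δ * ζ))⌉₊

variable {n : ℕ}

/-- The frequency `γ_J` of the column `J` in the `t₁ × R` matrix with rows `x`. -/
noncomputable def columnFreq {R : Finset (Fin n)} {t₁ : ℕ} (x : Fin t₁ → {j // j ∈ R} → Bool)
    (J : Fin t₁ → Bool) : ℝ :=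
  ((Finset.univ.filter fun i : {j // j ∈ R} => (fun j => x j i) = J).card : ℝ) / R.card

/-- `S` is a possible output of Approx-Centers on `R` and `x`: the numbers `γ_J n` are rounded up or
down to integers `Γ_J` with sum `n`, and `S` consists of the rows of a `t₁ × n` matrix that has
exactly `Γ_J` columns equal to `J`, for every `J`. -/
def ApproxCenters {R : Finset (Fin n)} {t₁ : ℕ} (x : Fin t₁ → {j // j ∈ R} → Bool)
    (S : Fin t₁ → Cube n) : Prop :=
  ∃ Γ : (Fin t₁ → Bool) → ℕ,
    (∀ J, Γ J = ⌊columnFreq x J * n⌋₊ ∨ Γ J = ⌈columnFreq x J * n⌉₊) ∧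
    ∑ J, Γ J = n ∧
    ∀ J, (Finset.univ.filter fun i : Fin n => (fun j => S j i) = J).card = Γ J

/-- `y` is assigned to `x i`: the index `i` is the least one with `dH y (x i) ≤ 2δ`. -/
def AssignedTo {R : Finset (Fin n)} {t₁ : ℕ} (δ : ℝ) (x : Fin t₁ → {j // j ∈ R} → Bool)
    (y : {j // j ∈ R} → Bool) (i : Fin t₁) : Prop :=
  dH y (x i) ≤ 2 * δ ∧ ∀ i' < i, ¬ dH y (x i') ≤ 2 * δ

open Classical in
/-- The number of vectors among `y` that are assigned to no `x i`. -/
noncomputable def unassigned {R : Finset (Fin n)} {t₁ t₂ : ℕ} (δ : ℝ)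
    (x : Fin t₁ → {j // j ∈ R} → Bool) (y : Fin t₂ → {j // j ∈ R} → Bool) : ℕ :=
  (Finset.univ.filter fun j => ∀ i, ¬ AssignedTo δ x (y j) i).card

open Classical in
/-- The weight of `x i`: the fraction of the vectors `y` that are assigned to it. -/
noncomputable def weight {R : Finset (Fin n)} {t₁ t₂ : ℕ} (δ : ℝ)
    (x : Fin t₁ → {j // j ∈ R} → Bool) (y : Fin t₂ → {j // j ∈ R} → Bool) (i : Fin t₁) : ℝ :=
  ((Finset.univ.filter fun j => AssignedTo δ x (y j) i).card : ℝ) / t₂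

/-- `o` is a possible output of Test-and-Learn when the restrictions to `R` of the two sequences of
samples are `x` and `y`. The value `none` stands for Fail. -/
def TestAndLearnStep {R : Finset (Fin n)} {t₁ t₂ : ℕ} (ζ δ : ℝ)
    (x : Fin t₁ → {j // j ∈ R} → Bool) (y : Fin t₂ → {j // j ∈ R} → Bool)
    (o : Option (Distr (Cube n))) : Prop :=
  (3 * ζ * t₂ < unassigned δ x y ∧ o = none) ∨
  (¬ 3 * ζ * t₂ < unassigned δ x y ∧
    ∃ S : Fin t₁ → Cube n, ApproxCenters x S ∧
    ∃ D' : Distr (Cube n), o = some D' ∧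
      (∀ i, weight δ x y i ≤ D' (S i)) ∧
      mass D' (Finset.univ.image S) = 1 ∧
      ∀ v, (∀ i, v ≠ S i) → D' v = 0)

/-- The possible values of the random index set `R`: the subsets of `[n]` of size `k`, or only
`[n]` itself if `n < k`. -/
abbrev IndexSet (n k : ℕ) : Type := {R : Finset (Fin n) // R.card = min k n}

instance (n k : ℕ) : Nonempty (IndexSet n k) := by
  obtain ⟨R, _, hR⟩ := Finset.exists_subset_card_eq
    (s := (Finset.univ : Finset (Fin n))) (n := min k n) (by simp)
  exact ⟨⟨R, hR⟩⟩

/-- An implementation of Test-and-Learn resolves the choices that the description leaves open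
(the rounding, the order of the columns, the output distribution), as a function of `R` and of the
answers to the queries. -/
structure Implementation (n t₁ t₂ k : ℕ) (ζ δ : ℝ) where
  out : (R : IndexSet n k) → (Fin (t₁ + t₂) → {j // j ∈ R.1} → Bool) → Option (Distr (Cube n))
  out_spec : ∀ R a, TestAndLearnStep ζ δ
    (fun i : Fin t₁ => a (Fin.castAdd t₂ i)) (fun j : Fin t₂ => a (Fin.natAdd t₁ j)) (out R a)

/-- Test-and-Learn: draw `t₁ + t₂` samples and, independently, a uniformly random index set `R` of
size `k`; query every sample exactly at the indices in `R`; the first `t₁` samples are used as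
centers and the remaining `t₂` samples to determine the weights. -/
noncomputable def testAndLearn {t₁ t₂ k : ℕ} {ζ δ : ℝ} (I : Implementation n t₁ t₂ k ζ δ) :
    NonAdaptiveAlgorithm n (t₁ + t₂) (Option (Distr (Cube n))) where
  Coins := IndexSet n k
  coinDist := uniform (IndexSet n k)
  queries R _ := R.1
  output R a := I.out R a

end Algorithm

end HugeObject

open HugeObject

/-!
Fix the index set `R` and the samples. Four quantities decide whether the run succeeds:
* `columnLoss`: how much the column frequencies of the matrix of centers change when only the
  indices in `R` are seen;
* `distLoss`: how much the distances of a random sample to the centers change;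
* `weightLoss`: how much the empirical weights `w i` differ from the probabilities of being assigned
  to the center `i`;
* `missedMass`: the mass of the clusters that contain none of the centers.

If the first three are small and the run does not fail, the output is close to `D`
(`exists_perm_dEM_le`): a permutation of the indices matches all but few columns of the centers with
those of the approximate centers (`exists_perm_mismatch_le`), so moving a typical sample to the
approximate center it is assigned to costs at most `5 δ`; at most `3 ζ` of the empirical mass is
unassigned, the weights are accurate up to `ζ`, and the samples with distorted distances have mass
at most `ζ / 2`. The approximate centers with positive weight are pairwise distinct, so that their
masses in the output add up. If the last three quantities are small and `D` is clusterable, the run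
does not fail (`not_fail_of_small_loss`): a sample outside the exceptional part that lies in a hit
cluster and is not distorted is assigned to some center.

All four quantities are small in expectation. For the first three this is a variance bound, for
sampling indices without replacement (`index_variance`) or for independent samples
(`empirical_variance`), summed over columns, centers and weights; no exponential tail bounds are
needed, because the sample sizes leave room for the dimension. A cluster of mass `p` contributes
`p (1 - p) ^ t₁ ≤ 1 / t₁` to the expected missed mass. With the constants `24, 48, 24`
each quantity has expectation at most `1 / 12` of its threshold, and a single application of
Markov's inequality to the sum of the four (`prob_le_third`) gives the failure probability `1 / 3`
in both parts.
-/

namespace HugeObject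

/-! ### Expectations over finite distributions -/

section Expectation

variable {α β : Type} [Fintype α] [Fintype β]

/-- The expectation of `f` under the distribution `D`. -/
noncomputable def expect (D : Distr α) (f : α → ℝ) : ℝ := ∑ a, D a * f a

theorem distr_nonneg (D : Distr α) (a : α) : 0 ≤ D a := D.2.1 a

theorem distr_sum (D : Distr α) : ∑ a, D a = 1 := D.2.2

theorem expect_mono (D : Distr α) {f g : α → ℝ} (h : ∀ a, f a ≤ g a) :
    expect D f ≤ expect D g :=
  Finset.sum_le_sum fun a _ => mul_le_mul_of_nonneg_left (h a) (distr_nonneg D a)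

theorem expect_nonneg (D : Distr α) {f : α → ℝ} (h : ∀ a, 0 ≤ f a) : 0 ≤ expect D f :=
  Finset.sum_nonneg fun a _ => mul_nonneg (distr_nonneg D a) (h a)

theorem expect_const (D : Distr α) (c : ℝ) : expect D (fun _ => c) = c := by
  simp only [expect, ← Finset.sum_mul, distr_sum, one_mul]

theorem expect_le_of_le (D : Distr α) {f : α → ℝ} {c : ℝ} (h : ∀ a, f a ≤ c) :
    expect D f ≤ c :=
  (expect_mono D h).trans_eq (expect_const D c)

theorem expect_add (D : Distr α) (f g : α → ℝ) :
    expect D (fun a => f a + g a) = expect D f + expect D g := by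
  simp only [expect, mul_add, Finset.sum_add_distrib]

theorem expect_mul_left (D : Distr α) (c : ℝ) (f : α → ℝ) :
    expect D (fun a => c * f a) = c * expect D f := by
  simp only [expect, Finset.mul_sum]
  exact Finset.sum_congr rfl fun a _ => by ring

theorem expect_sum {ι : Type} (D : Distr α) (s : Finset ι) (f : ι → α → ℝ) :
    expect D (fun a => ∑ i ∈ s, f i a) = ∑ i ∈ s, expect D (f i) := by
  simp only [expect, Finset.mul_sum]
  exact Finset.sum_comm

theorem expect_comm (D : Distr α) (D' : Distr β) (f : α → β → ℝ) :
    expect D (fun a => expect D' (f a)) = expect D' (fun b => expect D fun a => f a b) := by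
  simp only [expect, Finset.mul_sum]
  rw [Finset.sum_comm]
  exact Finset.sum_congr rfl fun b _ => Finset.sum_congr rfl fun a _ => by ring

/-- The distribution of `s` independent samples from `D`. -/
noncomputable def iid (D : Distr α) (s : ℕ) : Distr (Fin s → α) :=
  ⟨fun V => ∏ i, D (V i), fun V => Finset.prod_nonneg fun i _ => distr_nonneg D (V i), by
    classical
    have h := Finset.prod_univ_sum (fun _ : Fin s => (Finset.univ : Finset α)) (fun _ a => D a)
    rw [Fintype.piFinset_univ] at h
    rw [← h]
    simp⟩

theorem iid_apply (D : Distr α) (s : ℕ) (V : Fin s → α) : iid D s V = ∏ i, D (V i) := rfl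

theorem expect_iid_prod (D : Distr α) (s : ℕ) (g : Fin s → α → ℝ) :
    expect (iid D s) (fun V => ∏ i, g i (V i)) = ∏ i, expect D (g i) := by
  classical
  have h := Finset.prod_univ_sum (fun _ : Fin s => (Finset.univ : Finset α))
    (fun i a => D a * g i a)
  rw [Fintype.piFinset_univ] at h
  simp only [expect, h, iid_apply, Finset.prod_mul_distrib]

theorem expect_iid_append (D : Distr α) (s t : ℕ) (F : (Fin (s + t) → α) → ℝ) :
    expect (iid D (s + t)) F =
      expect (iid D s) fun X => expect (iid D t) fun Y => F (Fin.append X Y) := by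
  simp only [expect, Finset.mul_sum]
  rw [← (Fin.appendEquiv s t).sum_comp, Fintype.sum_prod_type]
  refine Finset.sum_congr rfl fun X _ => Finset.sum_congr rfl fun Y _ => ?_
  simp [iid_apply, Fin.appendEquiv, Fin.prod_univ_add, mul_assoc]

theorem expect_iid_cons (D : Distr α) (s : ℕ) (F : (Fin (s + 1) → α) → ℝ) :
    expect (iid D (s + 1)) F =
      expect D fun a => expect (iid D s) fun V => F (Fin.cons a V) := by
  simp only [expect, Finset.mul_sum]
  rw [← (Fin.consEquiv fun _ : Fin (s + 1) => α).sum_comp, Fintype.sum_prod_type]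
  refine Finset.sum_congr rfl fun X _ => Finset.sum_congr rfl fun Y _ => ?_
  simp [iid_apply, Fin.consEquiv, Fin.prod_univ_succ, mul_assoc]

theorem expect_iid_sum_eq_zero (D : Distr α) (s : ℕ) (g : α → ℝ) (hg : expect D g = 0) :
    expect (iid D s) (fun V => ∑ i, g (V i)) = 0 := by
  induction s with
  | zero => simp [expect]
  | succ s ih =>
    simp only [expect_iid_cons, Fin.sum_univ_succ, Fin.cons_zero, Fin.cons_succ, expect_add,
      expect_const, ih, hg, add_zero]

/-- The second moment of a sum of independent centered variables is the sum of the second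
moments. -/
theorem expect_iid_sum_sq (D : Distr α) (s : ℕ) (g : α → ℝ) (hg : expect D g = 0) :
    expect (iid D s) (fun V => (∑ i, g (V i)) ^ 2) = s * expect D (fun a => g a ^ 2) := by
  induction s with
  | zero => simp [expect]
  | succ s ih =>
    simp only [expect_iid_cons, Fin.sum_univ_succ, Fin.cons_zero, Fin.cons_succ, add_sq,
      expect_add, expect_const, ih, mul_assoc, expect_mul_left,
      expect_iid_sum_eq_zero D s g hg, mul_zero, add_zero]
    push_cast
    ring

theorem expect_indicator_nonneg (D : Distr α) (P : α → Prop) [DecidablePred P] :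
    0 ≤ expect D (fun a => if P a then 1 else 0) :=
  expect_nonneg D fun a => by split_ifs <;> norm_num

theorem expect_indicator_le_one (D : Distr α) (P : α → Prop) [DecidablePred P] :
    expect D (fun a => if P a then 1 else 0) ≤ 1 :=
  expect_le_of_le D fun a => by split_ifs <;> norm_num

/-- The empirical frequency of an event in `s` independent samples has variance at most `1/s`. -/
theorem empirical_variance (D : Distr α) {s : ℕ} (hs : 0 < s) (P : α → Prop) [DecidablePred P] :
    expect (iid D s) (fun V => (((Finset.univ.filter fun i => P (V i)).card : ℝ) / s -
      expect D (fun a => if P a then 1 else 0)) ^ 2) ≤ 1 / s := by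
  set p := expect D (fun a => if P a then 1 else 0) with hp
  have hp0 : 0 ≤ p := expect_indicator_nonneg D P
  have hp1 : p ≤ 1 := expect_indicator_le_one D P
  have hs' : (0 : ℝ) < s := by exact_mod_cast hs
  set g : α → ℝ := fun a => (if P a then 1 else 0) + -p with hg
  have hg0 : expect D g = 0 := by rw [hg, expect_add, expect_const, ← hp]; ring
  have h : ∀ V : Fin s → α, (((Finset.univ.filter fun i => P (V i)).card : ℝ) / s - p) ^ 2 =
      (1 / (s : ℝ) ^ 2) * (∑ i, g (V i)) ^ 2 := by
    intro V
    have : ∑ i, g (V i) = ((Finset.univ.filter fun i => P (V i)).card : ℝ) - s * p := by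
      simp [hg, Finset.sum_add_distrib]; ring
    rw [this]
    field_simp
  simp only [h, expect_mul_left, expect_iid_sum_sq D s g hg0]
  have h2 : expect D (fun a => g a ^ 2) ≤ 1 := by
    refine expect_le_of_le D fun a => ?_
    simp only [hg]
    split_ifs <;> nlinarith
  calc 1 / (s : ℝ) ^ 2 * ((s : ℝ) * expect D (fun a => g a ^ 2))
      ≤ 1 / (s : ℝ) ^ 2 * ((s : ℝ) * 1) := by
        gcongr
    _ = 1 / (s : ℝ) := by field_simp

end Expectation

/-! ### Sampling indices without replacement -/

section IndexSampling

variable {n k : ℕ}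

/-- The symmetry of the uniform index set under the permutations of `[n]`. -/
def permIndexSet (σ : Equiv.Perm (Fin n)) : IndexSet n k ≃ IndexSet n k :=
  σ.finsetCongr.subtypeEquiv fun R => by simp

theorem expect_uniform_perm (σ : Equiv.Perm (Fin n)) (f : IndexSet n k → ℝ) :
    expect (uniform (IndexSet n k)) (fun R => f (permIndexSet σ R)) =
      expect (uniform (IndexSet n k)) f :=
  (permIndexSet σ).sum_comp fun R => (uniform (IndexSet n k)) R * f R

theorem mem_permIndexSet (σ : Equiv.Perm (Fin n)) (R : IndexSet n k) (i : Fin n) :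
    i ∈ (permIndexSet σ R).1 ↔ σ.symm i ∈ R.1 := by
  simp [permIndexSet, Equiv.subtypeEquiv, Finset.mem_map_equiv]

/-- Sampling `k` indices without replacement: the mean of a centered function that is bounded by
`1` has second moment at most `1/k`, because distinct indices are negatively correlated. -/
theorem index_second_moment (hk : 0 < k) (a : Fin n → ℝ) (ha : ∑ i, a i = 0)
    (ha1 : ∀ i, |a i| ≤ 1) :
    expect (uniform (IndexSet n k)) (fun R => ((∑ i ∈ R.1, a i) / R.1.card) ^ 2) ≤ 1 / k := by
  have hk' : (0 : ℝ) < k := by exact_mod_cast hk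
  set U := uniform (IndexSet n k) with hU
  rcases le_or_gt n k with hnk | hnk
  · refine expect_le_of_le U fun R => ?_
    have : R.1 = Finset.univ := by
      rw [← Finset.card_eq_iff_eq_univ, R.2, Fintype.card_fin, min_eq_right hnk]
    rw [this, ha]
    simp
  set Q : Fin n → Fin n → ℝ :=
    fun i j => expect U fun R => (if i ∈ R.1 then 1 else 0) * (if j ∈ R.1 then 1 else 0) with hQ
  have hQ0 : ∀ i j, 0 ≤ Q i j := fun i j => expect_nonneg U fun R => by positivity
  -- By symmetry `Q i j` does not depend on `j ≠ i`.
  have hsymm : ∀ i j j', j ≠ i → j' ≠ i → Q i j = Q i j' := by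
    intro i j j' hj hj'
    simp only [hQ]
    rw [← expect_uniform_perm (Equiv.swap j j')]
    simp only [mem_permIndexSet, Equiv.symm_swap, Equiv.swap_apply_left,
      Equiv.swap_apply_of_ne_of_ne hj.symm hj'.symm]
    rfl
  have hrow : ∀ i, ∑ j, a i * a j * Q i j ≤ Q i i := by
    intro i
    obtain ⟨q, hq0, hq⟩ : ∃ q, 0 ≤ q ∧ ∀ j, j ≠ i → Q i j = q := by
      by_cases h : ∃ j, j ≠ i
      · obtain ⟨j, hj⟩ := h
        exact ⟨Q i j, hQ0 i j, fun j' hj' => hsymm i j' j hj' hj⟩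
      · push Not at h
        exact ⟨0, le_rfl, fun j hj => absurd (h j) hj⟩
    have h1 : ∑ j, a i * a j * Q i j = a i ^ 2 * (Q i i - q) := by
      have h2 : ∀ j, a i * a j * Q i j =
          a i * q * a j + (if j = i then a i ^ 2 * (Q i i - q) else 0) := by
        intro j
        split_ifs with hj
        · subst hj; ring
        · rw [hq j hj]; ring
      simp only [h2, Finset.sum_add_distrib, ← Finset.mul_sum, ha]
      simp
    have h3 : a i ^ 2 ≤ 1 := by rw [sq_le_one_iff_abs_le_one]; exact ha1 i
    rw [h1]
    nlinarith [hQ0 i i, sq_nonneg (a i), mul_nonneg (sq_nonneg (a i)) hq0]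
  have hcardR : ∀ R : IndexSet n k, R.1.card = k := fun R => R.2.trans (min_eq_left hnk.le)
  have hexp : expect U (fun R => (∑ i ∈ R.1, a i) ^ 2) = ∑ i, ∑ j, a i * a j * Q i j := by
    simp only [hQ, ← expect_mul_left, ← expect_sum]
    congr 1
    funext R
    have hind : ∑ i ∈ R.1, a i = ∑ i, if i ∈ R.1 then a i else 0 := by simp
    rw [sq, hind, Finset.sum_mul_sum]
    refine Finset.sum_congr rfl fun i _ => Finset.sum_congr rfl fun j _ => ?_
    split_ifs <;> simp
  have hdiag : ∑ i, Q i i = k := by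
    simp only [hQ, ← expect_sum]
    rw [← expect_const U (k : ℝ)]
    congr 1
    funext R
    simp [hcardR R]
  have hcard : ∀ R : IndexSet n k, ((∑ i ∈ R.1, a i) / (R.1.card : ℝ)) ^ 2 =
      (1 / (k : ℝ) ^ 2) * (∑ i ∈ R.1, a i) ^ 2 := by
    intro R
    simp only [hcardR R]
    ring
  simp only [hcard, expect_mul_left, hexp]
  calc 1 / (k : ℝ) ^ 2 * ∑ i, ∑ j, a i * a j * Q i j ≤ 1 / (k : ℝ) ^ 2 * (k : ℝ) := by
        rw [← hdiag]
        gcongr with i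
        exact hrow i
    _ = 1 / (k : ℝ) := by field_simp

/-- The frequency of a property of indices in the random index set has variance at most `1/k`. -/
theorem index_variance (hk : 0 < k) (P : Fin n → Prop) [DecidablePred P] :
    expect (uniform (IndexSet n k)) (fun R =>
      (((Finset.univ.filter fun i : {j // j ∈ R.1} => P i).card : ℝ) / R.1.card -
        ((Finset.univ.filter P).card : ℝ) / n) ^ 2) ≤ 1 / k := by
  rcases Nat.eq_zero_or_pos n with rfl | hn
  · refine expect_le_of_le _ fun R => ?_
    simp
  have hn' : (0 : ℝ) < n := by exact_mod_cast hn
  set m : ℝ := ((Finset.univ.filter P).card : ℝ) / n with hm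
  have hm0 : 0 ≤ m := by positivity
  have hm1 : m ≤ 1 := by
    rw [hm, div_le_one hn']
    exact_mod_cast (Finset.card_filter_le _ _).trans (by simp)
  set a : Fin n → ℝ := fun i => (if P i then 1 else 0) - m with ha
  have ha0 : ∑ i, a i = 0 := by
    simp only [ha, Finset.sum_sub_distrib, Finset.sum_boole, Finset.sum_const, Finset.card_univ,
      Fintype.card_fin, nsmul_eq_mul, hm]
    field_simp
    ring
  have ha1 : ∀ i, |a i| ≤ 1 := by
    intro i
    simp only [ha, abs_le]
    split_ifs <;> constructor <;> linarith
  refine le_trans (le_of_eq ?_) (index_second_moment hk a ha0 ha1)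
  congr 1
  funext R
  have hR : (R.1.card : ℝ) ≠ 0 := by
    rw [R.2]
    have : 0 < min k n := lt_min hk hn
    positivity
  have h1 : ((Finset.univ.filter fun i : {j // j ∈ R.1} => P i).card : ℝ) =
      ∑ i ∈ R.1, if P i then 1 else 0 := by
    rw [← Finset.sum_coe_sort R.1 (fun i => if P i then (1 : ℝ) else 0), Finset.sum_boole]
  have h2 : (∑ i ∈ R.1, a i) = (∑ i ∈ R.1, if P i then (1 : ℝ) else 0) - R.1.card * m := by
    simp [ha, Finset.sum_sub_distrib]
  rw [h1, h2]
  congr 1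
  field_simp

end IndexSampling

/-! ### Upper bounds for the Earth Mover Distance -/

section EarthMover

variable {n : ℕ}

theorem dH_nonneg {ι : Type} [Fintype ι] (x y : ι → Bool) : 0 ≤ dH x y := by
  unfold dH; positivity

theorem dH_le_one {ι : Type} [Fintype ι] (x y : ι → Bool) : dH x y ≤ 1 :=
  div_le_one_of_le₀ (by exact_mod_cast hammingDist_le_card_fintype) (by positivity)

theorem dH_triangle {ι : Type} [Fintype ι] (x y z : ι → Bool) : dH x z ≤ dH x y + dH y z := by
  unfold dH
  rw [← add_div]
  gcongr
  exact_mod_cast hammingDist_triangle x y z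

theorem dH_self {ι : Type} [Fintype ι] (x : ι → Bool) : dH x x = 0 := by simp [dH]

/-- A partial flow can be completed to a flow, in which the mass that was not moved yet costs at
most `1` per unit. -/
theorem dEM_le_of_partial_flow (D₁ D₂ : Distr (Cube n)) (g : Cube n → Cube n → ℝ)
    (hg : ∀ X Y, 0 ≤ g X Y) (hrow : ∀ X, ∑ Y, g X Y ≤ D₁ X) (hcol : ∀ Y, ∑ X, g X Y ≤ D₂ Y) :
    dEM D₁ D₂ ≤ ∑ X, ∑ Y, g X Y * dH X Y + (1 - ∑ X, ∑ Y, g X Y) := by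
  set l₁ : Cube n → ℝ := fun X => D₁ X - ∑ Y, g X Y with hl₁
  set l₂ : Cube n → ℝ := fun Y => D₂ Y - ∑ X, g X Y with hl₂
  set s : ℝ := 1 - ∑ X, ∑ Y, g X Y with hs
  have h₁ : ∀ X, 0 ≤ l₁ X := fun X => sub_nonneg.2 (hrow X)
  have h₂ : ∀ Y, 0 ≤ l₂ Y := fun Y => sub_nonneg.2 (hcol Y)
  have hs₁ : ∑ X, l₁ X = s := by simp only [hl₁, Finset.sum_sub_distrib, distr_sum, hs]
  have hs₂ : ∑ Y, l₂ Y = s := by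
    simp only [hl₂, Finset.sum_sub_distrib, distr_sum, hs]
    rw [Finset.sum_comm]
  have hs0 : 0 ≤ s := hs₁ ▸ Finset.sum_nonneg fun X _ => h₁ X
  have z₁ : ∀ X, s = 0 → l₁ X = 0 := fun X h =>
    (Finset.sum_eq_zero_iff_of_nonneg fun X _ => h₁ X).1 (hs₁.trans h) X (Finset.mem_univ X)
  have z₂ : ∀ X, s = 0 → l₂ X = 0 := fun X h =>
    (Finset.sum_eq_zero_iff_of_nonneg fun X _ => h₂ X).1 (hs₂.trans h) X (Finset.mem_univ X)
  -- If `s = 0`, then the quotients below are `0`, as they should be.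
  have hmem : (fun X Y => g X Y + l₁ X * l₂ Y / s) ∈ flows D₁ D₂ := by
    have hpos : ∀ X Y, 0 ≤ g X Y + l₁ X * l₂ Y / s := fun X Y =>
      add_nonneg (hg X Y) (div_nonneg (mul_nonneg (h₁ X) (h₂ Y)) hs0)
    have hsum : ∀ X, ∑ Y, (g X Y + l₁ X * l₂ Y / s) = D₁ X := by
      intro X
      rw [Finset.sum_add_distrib, ← Finset.sum_div, ← Finset.mul_sum, hs₂]
      rcases eq_or_ne s 0 with h | h
      · have := z₁ X h
        simp only [hl₁] at this
        rw [h]; simp; linarith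
      · rw [mul_div_cancel_right₀ _ h]; simp [hl₁]
    refine ⟨hsum, fun Y => ?_, fun X Y => ⟨hpos X Y, ?_⟩⟩
    · rw [Finset.sum_add_distrib, ← Finset.sum_div, ← Finset.sum_mul, hs₁]
      rcases eq_or_ne s 0 with h | h
      · have := z₂ Y h
        simp only [hl₂] at this
        rw [h]; simp; linarith
      · rw [mul_div_cancel_left₀ _ h]; simp [hl₂]
    · calc g X Y + l₁ X * l₂ Y / s ≤ ∑ Y, (g X Y + l₁ X * l₂ Y / s) :=
            Finset.single_le_sum (f := fun Y => g X Y + l₁ X * l₂ Y / s)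
              (fun Y _ => hpos X Y) (Finset.mem_univ Y)
        _ = D₁ X := hsum X
        _ ≤ 1 := (mem_Icc_of_mem_stdSimplex D₁.2 X).2
  have hbdd : BddBelow ((fun f : Cube n → Cube n → ℝ => ∑ X, ∑ Y, f X Y * dH X Y) ''
      flows D₁ D₂) := by
    refine ⟨0, ?_⟩
    rintro _ ⟨f, hf, rfl⟩
    exact Finset.sum_nonneg fun X _ => Finset.sum_nonneg fun Y _ =>
      mul_nonneg (hf.2.2 X Y).1 (dH_nonneg X Y)
  refine (csInf_le hbdd ⟨_, hmem, rfl⟩).trans ?_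
  have hle : ∑ X, ∑ Y, l₁ X * l₂ Y / s = s := by
    simp only [← Finset.sum_div, ← Finset.mul_sum, hs₂, ← Finset.sum_mul, hs₁]
    exact mul_self_div_self s
  calc ∑ X, ∑ Y, (g X Y + l₁ X * l₂ Y / s) * dH X Y
      ≤ ∑ X, ∑ Y, (g X Y * dH X Y + l₁ X * l₂ Y / s) := by
        refine Finset.sum_le_sum fun X _ => Finset.sum_le_sum fun Y _ => ?_
        rw [add_mul]
        gcongr
        exact mul_le_of_le_one_right (div_nonneg (mul_nonneg (h₁ X) (h₂ Y)) hs0) (dH_le_one X Y)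
    _ = _ := by simp only [Finset.sum_add_distrib, hle]

/-- Moving every `Y` to `b Y` as far as the capacities `D₂ V` permit. -/
theorem dEM_le_of_map (D D₂ : Distr (Cube n)) (b : Cube n → Cube n) :
    dEM D D₂ ≤ ∑ Y, D Y * dH Y (b Y) +
      (1 - ∑ V, min (mass D (Finset.univ.filter fun Y => b Y = V)) (D₂ V)) := by
  set p : Cube n → ℝ := fun V => mass D (Finset.univ.filter fun Y => b Y = V) with hp
  have hp0 : ∀ V, 0 ≤ p V := fun V => Finset.sum_nonneg fun Y _ => distr_nonneg D Y
  have hm0 : ∀ V, 0 ≤ min (p V) (D₂ V) := fun V => le_min (hp0 V) (distr_nonneg D₂ V)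
  set θ : Cube n → ℝ := fun V => min (p V) (D₂ V) / p V with hθ
  have hθ0 : ∀ V, 0 ≤ θ V := fun V => div_nonneg (hm0 V) (hp0 V)
  have hθ1 : ∀ V, θ V ≤ 1 := fun V => div_le_one_of_le₀ (min_le_left _ _) (hp0 V)
  set g : Cube n → Cube n → ℝ := fun Y V => if b Y = V then D Y * θ V else 0 with hg
  have hcol : ∀ V, ∑ Y, g Y V = min (p V) (D₂ V) := by
    intro V
    have : ∑ Y, g Y V = p V * θ V := by
      simp only [hg, hp, mass, Finset.sum_mul, Finset.sum_filter, ite_mul, zero_mul]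
    rw [this, hθ]
    rcases eq_or_ne (p V) 0 with h | h
    · simp [h, distr_nonneg D₂ V]
    · simp only; field_simp
  have hrow : ∀ Y, ∑ V, g Y V = D Y * θ (b Y) := fun Y => by simp [hg]
  have h := dEM_le_of_partial_flow D D₂ g
    (fun Y V => by
      simp only [hg]
      split_ifs
      exacts [mul_nonneg (distr_nonneg D Y) (hθ0 V), le_rfl])
    (fun Y => by rw [hrow]; exact mul_le_of_le_one_right (distr_nonneg D Y) (hθ1 _))
    (fun V => by rw [hcol]; exact min_le_right _ _)
  refine h.trans ?_
  have h1 : ∑ Y, ∑ V, g Y V = ∑ V, min (p V) (D₂ V) := by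
    rw [Finset.sum_comm]
    exact Finset.sum_congr rfl fun V _ => hcol V
  have h2 : ∑ Y, ∑ V, g Y V * dH Y V ≤ ∑ Y, D Y * dH Y (b Y) := by
    refine Finset.sum_le_sum fun Y _ => ?_
    have : ∑ V, g Y V * dH Y V = D Y * θ (b Y) * dH Y (b Y) := by simp [hg]
    rw [this]
    exact mul_le_mul_of_nonneg_right
      (mul_le_of_le_one_right (distr_nonneg D Y) (hθ1 _)) (dH_nonneg _ _)
  rw [h1]
  linarith

end EarthMover

/-! ### Matching the columns of two matrices -/

section Columns

/-- Two colourings of `[n]` agree, after a permutation, up to the differences of the sizes of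
their colour classes. -/
theorem exists_perm_mismatch_le {n : ℕ} {β : Type} [Fintype β] [DecidableEq β] (f g : Fin n → β) :
    ∃ σ : Equiv.Perm (Fin n), ((Finset.univ.filter fun p => f p ≠ g (σ p)).card : ℝ) ≤
      ∑ b, |((Finset.univ.filter fun p => f p = b).card : ℝ) -
        (Finset.univ.filter fun p => g p = b).card| := by
  obtain ⟨σ, -, hσ⟩ := Finset.exists_min_image (Finset.univ : Finset (Equiv.Perm (Fin n)))
    (fun σ => (Finset.univ.filter fun p => f p ≠ g (σ p)).card) ⟨1, Finset.mem_univ _⟩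
  refine ⟨σ, ?_⟩
  -- In an optimal `σ`, no colour is both wasted in `f` and wasted in `g ∘ σ`: a swap would help.
  have key : ∀ b p q, f p = b → g (σ p) ≠ b → f q ≠ b → g (σ q) = b → False := by
    intro b p q hfp hgp hfq hgq
    have hpq : p ≠ q := by rintro rfl; exact hfq hfp
    refine absurd (hσ (σ * Equiv.swap p q) (Finset.mem_univ _)) (not_le.2 ?_)
    refine Finset.card_lt_card ((Finset.ssubset_iff_of_subset ?_).2 ⟨p, ?_, ?_⟩)
    · intro x hx
      rw [Finset.mem_filter] at hx ⊢
      refine ⟨Finset.mem_univ _, ?_⟩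
      replace hx := hx.2
      rw [Equiv.Perm.mul_apply] at hx
      rcases eq_or_ne x p with rfl | hxp
      · rw [hfp]; exact hgp.symm
      rcases eq_or_ne x q with rfl | hxq
      · rw [hgq]; exact hfq
      rwa [Equiv.swap_apply_of_ne_of_ne hxp hxq] at hx
    · simp [hfp, hgp.symm]
    · rw [Finset.mem_filter, Equiv.Perm.mul_apply, Equiv.swap_apply_left, hfp, hgq]
      exact fun h => h.2 rfl
  have hfib : (Finset.univ.filter fun p => f p ≠ g (σ p)).card =
      ∑ b, (Finset.univ.filter fun p => f p = b ∧ g (σ p) ≠ b).card := by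
    rw [Finset.card_eq_sum_card_fiberwise (f := f) (t := Finset.univ) (by simp)]
    refine Finset.sum_congr rfl fun b _ => ?_
    rw [Finset.filter_filter]
    congr 1
    ext p
    simp only [Finset.mem_filter, Finset.mem_univ, true_and]
    constructor
    · rintro ⟨h, rfl⟩; exact ⟨rfl, h.symm⟩
    · rintro ⟨rfl, h⟩; exact ⟨h.symm, rfl⟩
  rw [hfib]
  push_cast
  refine Finset.sum_le_sum fun b _ => ?_
  have hg : (Finset.univ.filter fun p => g p = b).card =
      (Finset.univ.filter fun p => g (σ p) = b).card :=
    (Finset.card_equiv σ (by simp)).symm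
  have h1 : (Finset.univ.filter fun p => f p = b).card =
      (Finset.univ.filter fun p => f p = b ∧ g (σ p) = b).card +
      (Finset.univ.filter fun p => f p = b ∧ g (σ p) ≠ b).card := by
    rw [← Finset.card_filter_add_card_filter_not (s := Finset.univ.filter fun p => f p = b)
      (fun p => g (σ p) = b), Finset.filter_filter, Finset.filter_filter]
  have h2 : (Finset.univ.filter fun p => g (σ p) = b).card =
      (Finset.univ.filter fun p => f p = b ∧ g (σ p) = b).card +
      (Finset.univ.filter fun p => f p ≠ b ∧ g (σ p) = b).card := by
    rw [← Finset.card_filter_add_card_filter_not (s := Finset.univ.filter fun p => g (σ p) = b)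
      (fun p => f p = b), Finset.filter_filter, Finset.filter_filter]
    simp only [and_comm, ne_eq]
  rw [hg, h1, h2]
  push_cast
  rw [add_sub_add_left_eq_sub]
  rcases Finset.eq_empty_or_nonempty (Finset.univ.filter fun p => f p = b ∧ g (σ p) ≠ b)
    with h | ⟨p, hp⟩
  · rw [h]; simp
  · have : (Finset.univ.filter fun q => f q ≠ b ∧ g (σ q) = b) = ∅ := by
      rw [Finset.filter_eq_empty_iff]
      rintro q - ⟨hq1, hq2⟩
      have hp' := (Finset.mem_filter.1 hp).2
      exact key b p q hp'.1 hp'.2 hq1 hq2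
    rw [this]
    simp

/-- Non-negative reals with a natural number as their sum can be rounded without changing the
sum. -/
theorem exists_rounding {ι : Type} [Fintype ι] (a : ι → ℝ) (n : ℕ) (ha : ∀ i, 0 ≤ a i)
    (hsum : ∑ i, a i = n) :
    ∃ Γ : ι → ℕ, (∀ i, Γ i = ⌊a i⌋₊ ∨ Γ i = ⌈a i⌉₊) ∧ ∑ i, Γ i = n := by
  classical
  set N : Finset ι := Finset.univ.filter fun i => ⌈a i⌉₊ = ⌊a i⌋₊ + 1 with hN
  have hfloor : ∑ i, ⌊a i⌋₊ ≤ n := by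
    have : ((∑ i, ⌊a i⌋₊ : ℕ) : ℝ) ≤ n := by
      rw [← hsum]; push_cast
      exact Finset.sum_le_sum fun i _ => Nat.floor_le (ha i)
    exact_mod_cast this
  have hceil : n ≤ ∑ i, ⌊a i⌋₊ + N.card := by
    have h1 : (n : ℝ) ≤ (∑ i, ⌈a i⌉₊ : ℕ) := by
      rw [← hsum]; push_cast
      exact Finset.sum_le_sum fun i _ => Nat.le_ceil _
    have h2 : ∑ i, ⌈a i⌉₊ ≤ ∑ i, ⌊a i⌋₊ + N.card := by
      rw [hN, Finset.card_filter, ← Finset.sum_add_distrib]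
      refine Finset.sum_le_sum fun i _ => ?_
      have h3 := Nat.ceil_le_floor_add_one (a i)
      split_ifs with h <;> omega
    exact (by exact_mod_cast h1 : n ≤ _).trans h2
  obtain ⟨T, hTN, hT⟩ := Finset.exists_subset_card_eq (s := N) (n := n - ∑ i, ⌊a i⌋₊) (by omega)
  refine ⟨fun i => if i ∈ T then ⌊a i⌋₊ + 1 else ⌊a i⌋₊, fun i => ?_, ?_⟩
  · by_cases h : i ∈ T
    · right
      simp only [h, if_true]
      exact ((Finset.mem_filter.1 (hTN h)).2).symm
    · left; simp [h]
  · have : ∀ i, (if i ∈ T then ⌊a i⌋₊ + 1 else ⌊a i⌋₊) = ⌊a i⌋₊ + if i ∈ T then 1 else 0 := by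
      intro i; split_ifs <;> rfl
    simp only [this, Finset.sum_add_distrib, Finset.sum_boole, Finset.filter_univ_mem, hT]
    simp only [Nat.cast_id]
    omega

/-- Every list of class sizes with sum `n` is realized by a colouring of `[n]`. -/
theorem exists_coloring {n : ℕ} {β : Type} [Fintype β] [DecidableEq β] (Γ : β → ℕ)
    (h : ∑ b, Γ b = n) :
    ∃ f : Fin n → β, ∀ b, (Finset.univ.filter fun p => f p = b).card = Γ b := by
  have e : Fin n ≃ Σ b, Fin (Γ b) := Fintype.equivOfCardEq (by simp [h])
  refine ⟨fun p => (e p).1, fun b => ?_⟩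
  rw [← Fintype.card_subtype, ← Fintype.card_fin (Γ b)]
  have e' : {p // (e p).1 = b} ≃ {x : Σ b, Fin (Γ b) // x.1 = b} :=
    e.subtypeEquiv fun p => Iff.rfl
  exact Fintype.card_congr (e'.trans (Equiv.sigmaSubtype b))

end Columns

/-! ### The steps of Test-and-Learn can be carried out -/

section Existence

variable {n : ℕ}

theorem sum_columnFreq {R : Finset (Fin n)} (hR : R.Nonempty) {t₁ : ℕ}
    (x : Fin t₁ → {j // j ∈ R} → Bool) : ∑ J, columnFreq x J = 1 := by
  have hc : (R.card : ℝ) ≠ 0 := by exact_mod_cast hR.card_ne_zero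
  have h := Finset.card_eq_sum_card_fiberwise (s := (Finset.univ : Finset {j // j ∈ R}))
    (f := fun i j => x j i) (t := Finset.univ) (by simp)
  simp only [Finset.card_univ, Fintype.card_coe] at h
  simp only [columnFreq, ← Finset.sum_div]
  rw [div_eq_one_iff_eq hc]
  exact_mod_cast h.symm

theorem exists_approxCenters {R : Finset (Fin n)} (hR : R.Nonempty ∨ n = 0) {t₁ : ℕ}
    (x : Fin t₁ → {j // j ∈ R} → Bool) : ∃ S, ApproxCenters x S := by
  have hsum : ∑ J, columnFreq x J * n = n := by
    rw [← Finset.sum_mul]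
    rcases hR with hR | hn
    · rw [sum_columnFreq hR, one_mul]
    · simp [hn]
  obtain ⟨Γ, h1, h2⟩ := exists_rounding (fun J => columnFreq x J * n) n
    (fun J => by unfold columnFreq; positivity) hsum
  obtain ⟨f, hf⟩ := exists_coloring Γ h2
  exact ⟨fun j p => f p j, Γ, h1, h2, hf⟩

/-- The index to which a sample `Y` is assigned, if there is one, when the centers are
`X 0, X 1, …` and only the coordinates in `R` are seen. -/
noncomputable def assignment {t₁ : ℕ} (δ : ℝ) (R : Finset (Fin n)) (X : Fin t₁ → Cube n)
    (Y : Cube n) : Option (Fin t₁) :=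
  open Classical in
  if h : ∃ i, AssignedTo (R := R) δ (fun i j => X i j) (fun j => Y j) i then some h.choose else none

theorem AssignedTo.unique {R : Finset (Fin n)} {t₁ : ℕ} {δ : ℝ}
    {x : Fin t₁ → {j // j ∈ R} → Bool} {y : {j // j ∈ R} → Bool} {i i' : Fin t₁}
    (h : AssignedTo δ x y i) (h' : AssignedTo δ x y i') : i = i' := by
  rcases lt_trichotomy i i' with hlt | heq | hlt
  · exact absurd h.1 (h'.2 i hlt)
  · exact heq
  · exact absurd h'.1 (h.2 i' hlt)

theorem exists_assignedTo {R : Finset (Fin n)} {t₁ : ℕ} {δ : ℝ}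
    {x : Fin t₁ → {j // j ∈ R} → Bool} {y : {j // j ∈ R} → Bool} (i : Fin t₁)
    (h : dH y (x i) ≤ 2 * δ) : ∃ i', AssignedTo δ x y i' := by
  classical
  have hne : (Finset.univ.filter fun i => dH y (x i) ≤ 2 * δ).Nonempty := ⟨i, by simp [h]⟩
  refine ⟨Finset.min' _ hne, (Finset.mem_filter.1 (Finset.min'_mem _ hne)).2, fun i' hi' h' => ?_⟩
  exact absurd (Finset.min'_le _ i' (by simp [h'])) (not_le.2 hi')

theorem assignment_eq_some {t₁ : ℕ} {δ : ℝ} {R : Finset (Fin n)} {X : Fin t₁ → Cube n}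
    {Y : Cube n} {i : Fin t₁} : assignment δ R X Y = some i ↔
      AssignedTo (R := R) δ (fun i j => X i j) (fun j => Y j) i := by
  unfold assignment
  split_ifs with h
  · rw [Option.some_inj]
    exact ⟨fun hi => hi ▸ h.choose_spec, fun hi => h.choose_spec.unique hi⟩
  · simpa using fun hi => h ⟨i, hi⟩

theorem assignment_eq_none {t₁ : ℕ} {δ : ℝ} {R : Finset (Fin n)} {X : Fin t₁ → Cube n}
    {Y : Cube n} : assignment δ R X Y = none ↔
      ∀ i, ¬ AssignedTo (R := R) δ (fun i j => X i j) (fun j => Y j) i := by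
  rw [Option.eq_none_iff_forall_ne_some]
  exact forall_congr' fun i => not_congr assignment_eq_some

/-- The empirical weights. The value `none` collects the unassigned samples. -/
noncomputable def empirical {t₁ t₂ : ℕ} (δ : ℝ) (R : Finset (Fin n)) (X : Fin t₁ → Cube n)
    (Y : Fin t₂ → Cube n) (κ : Option (Fin t₁)) : ℝ :=
  ((Finset.univ.filter fun j => assignment δ R X (Y j) = κ).card : ℝ) / t₂

theorem empirical_nonneg {t₁ t₂ : ℕ} (δ : ℝ) (R : Finset (Fin n)) (X : Fin t₁ → Cube n)
    (Y : Fin t₂ → Cube n) (κ : Option (Fin t₁)) : 0 ≤ empirical δ R X Y κ := by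
  unfold empirical; positivity

theorem sum_empirical {t₁ t₂ : ℕ} (ht₂ : 0 < t₂) (δ : ℝ) (R : Finset (Fin n))
    (X : Fin t₁ → Cube n) (Y : Fin t₂ → Cube n) :
    empirical δ R X Y none + ∑ i, empirical δ R X Y (some i) = 1 := by
  have ht : (t₂ : ℝ) ≠ 0 := by exact_mod_cast ht₂.ne'
  have h := Finset.card_eq_sum_card_fiberwise (s := (Finset.univ : Finset (Fin t₂)))
    (f := fun j => assignment δ R X (Y j)) (t := Finset.univ) (by simp)
  simp only [Finset.card_univ, Fintype.card_fin] at h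
  rw [← Fintype.sum_option]
  simp only [empirical, ← Finset.sum_div]
  rw [div_eq_one_iff_eq ht]
  exact_mod_cast h.symm

theorem weight_eq_empirical {t₁ t₂ : ℕ} (δ : ℝ) (R : Finset (Fin n)) (X : Fin t₁ → Cube n)
    (Y : Fin t₂ → Cube n) (i : Fin t₁) :
    weight (R := R) δ (fun i j => X i j) (fun i j => Y i j) i = empirical δ R X Y (some i) := by
  simp only [weight, empirical]
  congr 3
  ext j
  simp only [Finset.mem_filter, assignment_eq_some]

theorem unassigned_eq_empirical {t₁ t₂ : ℕ} (ht₂ : 0 < t₂) (δ : ℝ) (R : Finset (Fin n))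
    (X : Fin t₁ → Cube n) (Y : Fin t₂ → Cube n) :
    (unassigned (R := R) δ (fun i j => X i j) (fun i j => Y i j) : ℝ) =
      empirical δ R X Y none * t₂ := by
  have ht : (t₂ : ℝ) ≠ 0 := by exact_mod_cast ht₂.ne'
  simp only [unassigned, empirical]
  rw [div_mul_cancel₀ _ ht]
  congr 2
  ext j
  simp only [Finset.mem_filter, assignment_eq_none]

theorem sum_weight_le_one {R : Finset (Fin n)} {t₁ t₂ : ℕ} (δ : ℝ)
    (x : Fin t₁ → {j // j ∈ R} → Bool) (y : Fin t₂ → {j // j ∈ R} → Bool) :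
    ∑ i, weight δ x y i ≤ 1 := by
  classical
  simp only [weight, ← Finset.sum_div]
  refine div_le_one_of_le₀ ?_ (by positivity)
  have hdisj : Set.PairwiseDisjoint ((Finset.univ : Finset (Fin t₁)) : Set (Fin t₁))
      fun i => Finset.univ.filter fun j => AssignedTo δ x (y j) i := by
    intro i _ i' _ hne
    refine Finset.disjoint_filter.2 fun j _ h h' => hne (h.unique h')
  have h := Finset.card_biUnion hdisj
  have h2 := (Finset.card_le_univ (Finset.univ.biUnion fun i : Fin t₁ =>
    Finset.univ.filter fun j => AssignedTo δ x (y j) i)).trans_eq (Fintype.card_fin t₂)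
  rw [h] at h2
  exact_mod_cast h2

/-- All choices of Test-and-Learn can be made. -/
theorem exists_testAndLearnStep {R : Finset (Fin n)} (hR : R.Nonempty ∨ n = 0) {t₁ t₂ : ℕ}
    (ht₁ : 0 < t₁) (ζ δ : ℝ) (x : Fin t₁ → {j // j ∈ R} → Bool)
    (y : Fin t₂ → {j // j ∈ R} → Bool) : ∃ o, TestAndLearnStep ζ δ x y o := by
  classical
  by_cases hfail : 3 * ζ * t₂ < unassigned δ x y
  · exact ⟨none, Or.inl ⟨hfail, rfl⟩⟩
  obtain ⟨S, hS⟩ := exists_approxCenters hR x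
  set w := weight δ x y with hw
  have hw0 : ∀ i, 0 ≤ w i := fun i => by simp only [hw, weight]; positivity
  -- The mass that the weights leave over goes to an arbitrary center.
  set i₀ : Fin t₁ := ⟨0, ht₁⟩
  set u : Fin t₁ → ℝ := fun i => w i + if i = i₀ then 1 - ∑ i, w i else 0 with hu
  have hwu : ∀ i, w i ≤ u i := fun i => by
    have := sum_weight_le_one δ x y
    simp only [hu]
    split_ifs <;> linarith
  have hu0 : ∀ i, 0 ≤ u i := fun i => (hw0 i).trans (hwu i)
  have hu1 : ∑ i, u i = 1 := by simp [hu, Finset.sum_add_distrib]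
  set f : Cube n → ℝ := fun v => ∑ i, if S i = v then u i else 0 with hf
  have hf0 : ∀ v i, 0 ≤ if S i = v then u i else 0 := fun v i => by
    split_ifs
    exacts [hu0 i, le_rfl]
  have hf1 : ∑ v, f v = 1 := by
    simp only [hf]
    rw [Finset.sum_comm]
    simpa using hu1
  have hfz : ∀ v, (∀ i, v ≠ S i) → f v = 0 := fun v hv =>
    Finset.sum_eq_zero fun i _ => if_neg (hv i).symm
  refine ⟨some ⟨f, fun v => Finset.sum_nonneg fun i _ => hf0 v i, hf1⟩,
    Or.inr ⟨hfail, S, hS, _, rfl, fun i => ?_, ?_, hfz⟩⟩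
  · refine (hwu i).trans ?_
    have := Finset.single_le_sum (f := fun i' => if S i' = S i then u i' else 0)
      (fun i' _ => hf0 (S i) i') (Finset.mem_univ i)
    simp only [if_true] at this
    exact this
  · refine Eq.trans ?_ hf1
    refine Finset.sum_subset (Finset.subset_univ _) fun v _ hv => hfz v fun i hi => hv ?_
    simp [hi]

theorem nonempty_implementation (n t₁ t₂ k : ℕ) (ζ δ : ℝ) (ht₁ : 0 < t₁) (hk : 0 < k) :
    Nonempty (Implementation n t₁ t₂ k ζ δ) := by
  have h : ∀ (R : IndexSet n k) (a : Fin (t₁ + t₂) → {j // j ∈ R.1} → Bool),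
      ∃ o, TestAndLearnStep ζ δ (fun i : Fin t₁ => a (Fin.castAdd t₂ i))
        (fun j : Fin t₂ => a (Fin.natAdd t₁ j)) o := by
    intro R a
    refine exists_testAndLearnStep ?_ ht₁ ζ δ _ _
    rcases Nat.eq_zero_or_pos n with hn | hn
    · exact Or.inr hn
    · refine Or.inl (Finset.card_pos.1 ?_)
      rw [R.2]
      exact lt_min hk hn
  choose out hout using h
  exact ⟨⟨out, hout⟩⟩

end Existence

/-! ### Correctness of a run with small deviations -/

section Run

variable {n t₁ t₂ : ℕ}

/-- The probability under `D` of being assigned to the center `κ`, where `none` stands for being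
unassigned. -/
noncomputable def assignProb (D : Distr (Cube n)) (δ : ℝ) (R : Finset (Fin n))
    (X : Fin t₁ → Cube n) (κ : Option (Fin t₁)) : ℝ :=
  expect D fun Y => if assignment δ R X Y = κ then 1 else 0

/-- The number of columns of the full matrix with rows `X` that are equal to `J`. -/
def columnCount (X : Fin t₁ → Cube n) (J : Fin t₁ → Bool) : ℕ :=
  (Finset.univ.filter fun p => (fun i => X i p) = J).card

/-- The scaled squared deviation of the column frequencies in `R` from those in `[n]`. -/
noncomputable def columnLoss (R : Finset (Fin n)) (X : Fin t₁ → Cube n) : ℝ :=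
  2 ^ t₁ * ∑ J, (columnFreq (R := R) (fun i j => X i j) J - (columnCount X J : ℝ) / n) ^ 2

/-- The expected squared deviation of the distances in `R` from a random sample to the centers
from the distances in `[n]`. -/
noncomputable def distLoss (D : Distr (Cube n)) (R : Finset (Fin n)) (X : Fin t₁ → Cube n) : ℝ :=
  ∑ i, expect D fun Y =>
    (dH (fun j : {j // j ∈ R} => Y j) (fun j => X i j) - dH Y (X i)) ^ 2

/-- The scaled squared deviation of the empirical weights from the assignment probabilities. -/
noncomputable def weightLoss (D : Distr (Cube n)) (δ : ℝ) (R : Finset (Fin n))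
    (X : Fin t₁ → Cube n) (Y : Fin t₂ → Cube n) : ℝ :=
  (t₁ + 1) * ∑ κ, (empirical δ R X Y κ - assignProb D δ R X κ) ^ 2

/-- The mass of the clusters that contain none of the centers `X`. -/
noncomputable def missedMass {s : ℕ} (D : Distr (Cube n)) (C : Fin s → Finset (Cube n))
    (X : Fin t₁ → Cube n) : ℝ :=
  ∑ j, mass D (C j) * ∏ i, if X i ∈ C j then 0 else 1

/-- `Y` is distorted by `R` if its distance to some center changes by more than `δ`. -/
def Distorted (δ : ℝ) (R : Finset (Fin n)) (X : Fin t₁ → Cube n) (Y : Cube n) : Prop :=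
  ∃ i, δ < |dH (fun j : {j // j ∈ R} => Y j) (fun j => X i j) - dH Y (X i)|

open Classical in
theorem prob_distorted_le (D : Distr (Cube n)) {δ : ℝ} (hδ : 0 < δ) (R : Finset (Fin n))
    (X : Fin t₁ → Cube n) :
    δ ^ 2 * expect D (fun Y => if Distorted δ R X Y then 1 else 0) ≤ distLoss D R X := by
  rw [distLoss, ← expect_sum, ← expect_mul_left]
  refine expect_mono D fun Y => ?_
  have hpos : ∀ i ∈ (Finset.univ : Finset (Fin t₁)),
      0 ≤ (dH (fun j : {j // j ∈ R} => Y j) (fun j => X i j) - dH Y (X i)) ^ 2 :=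
    fun i _ => sq_nonneg _
  split_ifs with h
  · obtain ⟨i, hi⟩ := h
    rw [mul_one]
    refine le_trans ?_ (Finset.single_le_sum hpos (Finset.mem_univ i))
    rw [← sq_abs (_ - _)]
    exact pow_le_pow_left₀ hδ.le hi.le 2
  · rw [mul_zero]
    exact Finset.sum_nonneg hpos

/-- By Cauchy-Schwarz, a bound for the sum of squares bounds the `ℓ₁`-norm. -/
theorem sum_abs_lt_of_card_mul_sum_sq_lt {ι : Type} [Fintype ι] (a : ι → ℝ) {c : ℝ} (hc : 0 < c)
    (h : Fintype.card ι * ∑ i, a i ^ 2 < c ^ 2) : ∑ i, |a i| < c := by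
  refine lt_of_pow_lt_pow_left₀ 2 hc.le (lt_of_le_of_lt ?_ h)
  have := sq_sum_le_card_mul_sum_sq (s := (Finset.univ : Finset ι)) (f := fun i => |a i|)
  simpa using this

theorem sum_abs_weight_lt {D : Distr (Cube n)} {ζ δ : ℝ} (hζ : 0 < ζ) {R : Finset (Fin n)}
    {X : Fin t₁ → Cube n} {Y : Fin t₂ → Cube n} (h : weightLoss D δ R X Y < ζ ^ 2) :
    ∑ κ, |empirical δ R X Y κ - assignProb D δ R X κ| < ζ := by
  refine sum_abs_lt_of_card_mul_sum_sq_lt _ hζ ?_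
  simpa [weightLoss] using h

/-- If the column frequencies of `R` are close to those of `[n]`, then the approximate centers are
close to the centers after a permutation of the indices. -/
theorem exists_perm_dH_centers_le {δ : ℝ} (hδ : 0 < δ) {k : ℕ} (hk : (2 : ℝ) ^ t₁ ≤ δ * k)
    {R : Finset (Fin n)} (hR : R.card = min k n) {X : Fin t₁ → Cube n}
    (hloss : columnLoss R X < δ ^ 2) {S : Fin t₁ → Cube n}
    (hS : ApproxCenters (R := R) (fun i j => X i j) S) :
    ∃ σ : Equiv.Perm (Fin n), ∀ i, dH (X i) (fun p => S i (σ p)) ≤ 2 * δ := by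
  obtain ⟨Γ, hΓ, -, hcount⟩ := hS
  obtain ⟨σ, hσ⟩ := exists_perm_mismatch_le (fun p i => X i p) (fun p i => S i p)
  refine ⟨σ, fun i => ?_⟩
  rcases Nat.eq_zero_or_pos n with rfl | hn
  · simp only [dH, Fintype.card_fin, Nat.cast_zero, div_zero]
    positivity
  have hn' : (0 : ℝ) < n := by exact_mod_cast hn
  set γ := columnFreq (R := R) (fun i j => X i j) with hγ
  have hfreq : ∑ J, |γ J - (columnCount X J : ℝ) / n| < δ := by
    refine sum_abs_lt_of_card_mul_sum_sq_lt _ hδ ?_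
    simpa [columnLoss] using hloss
  -- The error of rounding is at most `1` per column, and it vanishes if `R` is all of `[n]`.
  have hround : ∑ J, |γ J * n - Γ J| ≤ δ * n := by
    rcases le_or_gt n k with hnk | hnk
    · have : ∀ J, |γ J * n - Γ J| = 0 := by
        intro J
        have hint : γ J * n = ((Finset.univ.filter fun p : {j // j ∈ R} =>
            (fun i => X i p) = J).card : ℝ) := by
          simp only [hγ, columnFreq, hR, min_eq_right hnk]
          field_simp
        rw [abs_eq_zero, sub_eq_zero]
        rcases hΓ J with h | h <;> rw [h, hint] <;> simp
      simp only [this, Finset.sum_const_zero]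
      positivity
    · calc ∑ J, |γ J * n - Γ J| ≤ ∑ _J : Fin t₁ → Bool, (1 : ℝ) := by
            refine Finset.sum_le_sum fun J _ => ?_
            have h0 : 0 ≤ γ J * n := by simp only [hγ, columnFreq]; positivity
            rw [abs_le]
            rcases hΓ J with h | h <;> rw [h]
            · have h1 := Nat.floor_le h0
              have h2 := Nat.lt_floor_add_one (γ J * n)
              constructor <;> linarith
            · have h1 := Nat.le_ceil (γ J * n)
              have h2 := Nat.ceil_lt_add_one h0
              constructor <;> linarith
        _ = 2 ^ t₁ := by simp
        _ ≤ δ * k := hk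
        _ ≤ δ * n := by gcongr
  have hmis : (hammingDist (X i) (fun p => S i (σ p)) : ℝ) ≤ 2 * δ * n := by
    calc (hammingDist (X i) (fun p => S i (σ p)) : ℝ)
        ≤ ((Finset.univ.filter fun p => (fun i => X i p) ≠ fun i => S i (σ p)).card : ℝ) := by
          unfold hammingDist
          refine Nat.cast_le.2 (Finset.card_le_card fun p hp => ?_)
          rw [Finset.mem_filter] at hp ⊢
          exact ⟨hp.1, fun h => hp.2 (congrFun h i)⟩
      _ ≤ ∑ J, |(columnCount X J : ℝ) - Γ J| := by
          refine hσ.trans_eq (Finset.sum_congr rfl fun J _ => ?_)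
          rw [hcount J, columnCount]
      _ ≤ ∑ J, (|γ J - (columnCount X J : ℝ) / n| * n + |γ J * n - Γ J|) := by
          refine Finset.sum_le_sum fun J _ => ?_
          have : |γ J - (columnCount X J : ℝ) / n| * n = |columnCount X J - γ J * n| := by
            rw [← abs_of_pos hn', ← abs_mul, abs_of_pos hn', abs_sub_comm]
            congr 1
            field_simp
          rw [this]
          exact abs_sub_le _ _ _
      _ = (∑ J, |γ J - (columnCount X J : ℝ) / n|) * n + ∑ J, |γ J * n - Γ J| := by
          rw [Finset.sum_add_distrib, Finset.sum_mul]
      _ ≤ δ * n + δ * n := by gcongr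
      _ = 2 * δ * n := by ring
  rw [dH, Fintype.card_fin, div_le_iff₀ hn']
  exact hmis

/-- A column that occurs in `R` survives the rounding, because its scaled frequency is at least
`1`; hence different rows stay different. -/
theorem ApproxCenters.ne {R : Finset (Fin n)} {x : Fin t₁ → {j // j ∈ R} → Bool}
    {S : Fin t₁ → Cube n} (hS : ApproxCenters x S) {i i' : Fin t₁} (h : x i ≠ x i') :
    S i ≠ S i' := by
  obtain ⟨j, hj⟩ := Function.ne_iff.1 h
  obtain ⟨Γ, hΓ, -, hcount⟩ := hS
  set J : Fin t₁ → Bool := fun i => x i j with hJ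
  have hRpos : 0 < R.card := Finset.card_pos.2 ⟨j.1, j.2⟩
  have hRn : R.card ≤ n := (Finset.card_le_univ R).trans_eq (Fintype.card_fin n)
  have h1 : (1 : ℝ) ≤ columnFreq x J * n := by
    have hcard : 1 ≤ (Finset.univ.filter fun p : {j // j ∈ R} => (fun i => x i p) = J).card :=
      Finset.card_pos.2 ⟨j, by simp [hJ]⟩
    rw [columnFreq, div_mul_eq_mul_div, one_le_div (by exact_mod_cast hRpos)]
    exact_mod_cast hRn.trans (Nat.le_mul_of_pos_left n hcard)
  have h2 : 0 < Γ J := by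
    rcases hΓ J with h | h <;> rw [h]
    · exact Nat.floor_pos.2 h1
    · exact Nat.ceil_pos.2 (by linarith)
  rw [← hcount J] at h2
  obtain ⟨p, hp⟩ := Finset.card_pos.1 h2
  have hp' := (Finset.mem_filter.1 hp).2
  intro hSS
  apply hj
  have e1 := congrFun hp' i
  have e2 := congrFun hp' i'
  simp only [hJ] at e1 e2
  rw [← e1, ← e2, hSS]

/-- If the deviations are small and the run does not fail, then the output is close to `D`. -/
theorem exists_perm_dEM_le {D D' : Distr (Cube n)} {ζ δ : ℝ} (hζ : 0 < ζ) (hδ : 0 < δ) {k : ℕ}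
    (hk : (2 : ℝ) ^ t₁ ≤ δ * k) (ht₂ : 0 < t₂) {R : Finset (Fin n)} (hR : R.card = min k n)
    {X : Fin t₁ → Cube n} {Y : Fin t₂ → Cube n}
    (hcol : columnLoss R X < δ ^ 2) (hdist : distLoss D R X < δ ^ 2 * (ζ / 2))
    (hw : weightLoss D δ R X Y < ζ ^ 2)
    (hstep : TestAndLearnStep (R := R) ζ δ (fun i j => X i j) (fun i j => Y i j) (some D')) :
    ∃ σ : Equiv.Perm (Fin n), dEM D (permute D' σ) ≤ 17 * (δ + ζ) := by
  classical
  rcases hstep with ⟨-, h⟩ | ⟨hfail, S, hS, D'', hD'', hweight, -, -⟩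
  · exact absurd h (by simp)
  obtain rfl : D' = D'' := Option.some_inj.1 hD''
  obtain ⟨σ, hσ⟩ := exists_perm_dH_centers_le hδ hk hR hcol hS
  refine ⟨σ, ?_⟩
  set Z : Fin t₁ → Cube n := fun i p => S i (σ p) with hZ
  set w : Option (Fin t₁) → ℝ := empirical δ R X Y with hwdef
  set q : Option (Fin t₁) → ℝ := assignProb D δ R X with hqdef
  have hZD : ∀ i, w (some i) ≤ permute D' σ (Z i) := by
    intro i
    rw [permute_apply, hwdef, ← weight_eq_empirical]
    exact hweight i
  set b : Cube n → Cube n := fun V => (assignment δ R X V).elim V Z with hb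
  have hbsome : ∀ V i, assignment δ R X V = some i → b V = Z i := by
    intro V i h
    simp [hb, h]
  refine (dEM_le_of_map D (permute D' σ) b).trans ?_
  have hcost : ∑ V, D V * dH V (b V) ≤ 5 * δ + ζ / 2 := by
    have h1 : expect D (fun V => dH V (b V)) ≤
        expect D (fun V => 5 * δ + if Distorted δ R X V then 1 else 0) := by
      refine expect_mono D fun V => ?_
      rcases h : assignment δ R X V with _ | i
      · have : b V = V := by simp [hb, h]
        rw [this, dH_self]
        split_ifs <;> linarith
      · rw [hbsome V i h]
        split_ifs with hV
        · linarith [dH_le_one V (Z i)]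
        · have h2 := (assignment_eq_some.1 h).1
          have h3 := (abs_le.1 (not_lt.1 fun hi => hV ⟨i, hi⟩)).1
          linarith [dH_triangle V (X i) (Z i), hσ i]
    have h2 : expect D (fun V => if Distorted δ R X V then 1 else 0) < ζ / 2 :=
      lt_of_mul_lt_mul_left ((prob_distorted_le D hδ R X).trans_lt hdist) (by positivity)
    rw [expect_add, expect_const] at h1
    exact h1.trans (by linarith)
  have hfail' : w none ≤ 3 * ζ := by
    rw [unassigned_eq_empirical ht₂, not_lt] at hfail
    exact le_of_mul_le_mul_right hfail (by exact_mod_cast ht₂)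
  -- Centers of positive weight are distinct, so that their masses in the output add up.
  set I : Finset (Fin t₁) := Finset.univ.filter fun i => 0 < w (some i) with hI
  have hinj : Set.InjOn Z I := by
    have key : ∀ i i', i < i' → 0 < w (some i') → Z i ≠ Z i' := by
      intro i i' hlt hpos hZZ
      have hne : (Finset.univ.filter fun j => assignment δ R X (Y j) = some i').Nonempty := by
        rw [Finset.nonempty_iff_ne_empty]
        intro hempty
        simp [hwdef, empirical, hempty] at hpos
      obtain ⟨j, hj⟩ := hne
      have hj' := assignment_eq_some.1 (Finset.mem_filter.1 hj).2
      refine hS.ne (i := i) (i' := i') (fun hx => hj'.2 i hlt ?_) ?_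
      · exact (congrArg (dH _) hx).trans_le hj'.1
      · funext p
        have := congrFun hZZ (σ.symm p)
        simpa [hZ] using this
    intro i hi i' hi' hZZ
    have hi := (Finset.mem_filter.1 (Finset.mem_coe.1 hi)).2
    have hi' := (Finset.mem_filter.1 (Finset.mem_coe.1 hi')).2
    rcases lt_trichotomy i i' with h | h | h
    · exact absurd hZZ (key i i' h hi')
    · exact h
    · exact absurd hZZ.symm (key i' i h hi)
  have hq : ∀ i, q (some i) ≤ mass D (Finset.univ.filter fun V => b V = Z i) := by
    intro i
    simp only [hqdef, assignProb, expect, mass, Finset.sum_filter]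
    refine Finset.sum_le_sum fun V _ => ?_
    have := distr_nonneg D V
    by_cases h : assignment δ R X V = some i
    · simp [h, hbsome V i h]
    · simp only [h, if_false, mul_zero]
      split_ifs
      exacts [this, le_rfl]
  have hq0 : ∀ κ, 0 ≤ q κ := fun κ => expect_indicator_nonneg D _
  have hmoved : ∑ i, min (q (some i)) (w (some i)) ≤
      ∑ V, min (mass D (Finset.univ.filter fun V' => b V' = V)) (permute D' σ V) := by
    calc ∑ i, min (q (some i)) (w (some i)) = ∑ i ∈ I, min (q (some i)) (w (some i)) := by
          symm
          refine Finset.sum_subset (Finset.subset_univ I) fun i _ hi => ?_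
          have : ¬ 0 < w (some i) := fun h => hi (by simp [hI, h])
          have h0 : w (some i) = 0 := le_antisymm (not_lt.1 this) (empirical_nonneg _ _ _ _ _)
          rw [h0, min_eq_right (hq0 _)]
      _ ≤ ∑ i ∈ I, min (mass D (Finset.univ.filter fun V' => b V' = Z i))
            (permute D' σ (Z i)) :=
          Finset.sum_le_sum fun i _ => min_le_min (hq i) (hZD i)
      _ = ∑ V ∈ I.image Z, min (mass D (Finset.univ.filter fun V' => b V' = V))
            (permute D' σ V) :=
          (Finset.sum_image (f := fun V => min (mass D (Finset.univ.filter fun V' => b V' = V))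
            (permute D' σ V)) hinj).symm
      _ ≤ _ := Finset.sum_le_sum_of_subset_of_nonneg (Finset.subset_univ _) fun V _ _ =>
          le_min (Finset.sum_nonneg fun V' _ => distr_nonneg D V') (distr_nonneg _ V)
  have hdev := sum_abs_weight_lt hζ hw
  rw [Fintype.sum_option] at hdev
  have hmin : ∑ i, w (some i) - ∑ i, |w (some i) - q (some i)| ≤
      ∑ i, min (q (some i)) (w (some i)) := by
    rw [← Finset.sum_sub_distrib]
    refine Finset.sum_le_sum fun i _ => le_min ?_ ?_
    · linarith [le_abs_self (w (some i) - q (some i))]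
    · linarith [abs_nonneg (w (some i) - q (some i))]
  have htot : w none + ∑ i, w (some i) = 1 := sum_empirical ht₂ δ R X Y
  have habs := abs_nonneg (w none - q none)
  linarith

/-- If the deviations are small and the centers hit almost all clusters, then the run does not
fail. -/
theorem not_fail_of_small_loss {D : Distr (Cube n)} {ζ δ : ℝ} (hζ : 0 < ζ) (hδ : 0 < δ)
    (ht₂ : 0 < t₂) {s : ℕ} {C : Fin (s + 1) → Finset (Cube n)} (hcover : ∀ V, ∃ i, V ∈ C i)
    (hzero : mass D (C 0) ≤ ζ) (hdiam : ∀ i, i ≠ 0 → ∀ U ∈ C i, ∀ V ∈ C i, dH U V ≤ δ)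
    {R : Finset (Fin n)} {X : Fin t₁ → Cube n} {Y : Fin t₂ → Cube n}
    (hdist : distLoss D R X < δ ^ 2 * (ζ / 2)) (hw : weightLoss D δ R X Y < ζ ^ 2)
    (hmiss : missedMass D (fun j => C j.succ) X < ζ / 2) :
    ¬ 3 * ζ * t₂ < unassigned (R := R) δ (fun i j => X i j) (fun i j => Y i j) := by
  classical
  have hbad : expect D (fun V => if Distorted δ R X V then 1 else 0) < ζ / 2 :=
    lt_of_mul_lt_mul_left ((prob_distorted_le D hδ R X).trans_lt hdist) (by positivity)
  have hmass : ∀ B : Finset (Cube n), expect D (fun V => if V ∈ B then 1 else 0) = mass D B := by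
    intro B
    simp [expect, mass]
  have hprod : ∀ j : Fin s, (0 : ℝ) ≤ ∏ i, if X i ∈ C j.succ then 0 else 1 := fun j =>
    Finset.prod_nonneg fun i _ => by split_ifs <;> norm_num
  have hnone : assignProb D δ R X none ≤
      mass D (C 0) + (missedMass D (fun j => C j.succ) X +
        expect D (fun V => if Distorted δ R X V then 1 else 0)) := by
    have hsplit : mass D (C 0) + (missedMass D (fun j => C j.succ) X +
        expect D (fun V => if Distorted δ R X V then 1 else 0)) =
        expect D fun V => (if V ∈ C 0 then 1 else 0) +
          ((∑ j : Fin s, (∏ i, if X i ∈ C j.succ then 0 else 1) *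
            (if V ∈ C j.succ then 1 else 0)) + if Distorted δ R X V then 1 else 0) := by
      simp only [expect_add, expect_sum, expect_mul_left, hmass, missedMass]
      simp only [mul_comm]
    rw [hsplit]
    refine expect_mono D fun V => ?_
    have h0 : (0 : ℝ) ≤ if V ∈ C 0 then 1 else 0 := by split_ifs <;> norm_num
    have h1 : ∀ j ∈ (Finset.univ : Finset (Fin s)),
        (0 : ℝ) ≤ (∏ i, if X i ∈ C j.succ then 0 else 1) * (if V ∈ C j.succ then 1 else 0) :=
      fun j _ => mul_nonneg (hprod j) (by split_ifs <;> norm_num)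
    have h2 : (0 : ℝ) ≤ if Distorted δ R X V then 1 else 0 := by split_ifs <;> norm_num
    have h1' := Finset.sum_nonneg h1
    by_cases hV : assignment δ R X V = none
    swap
    · rw [if_neg hV]; positivity
    rw [if_pos hV]
    obtain ⟨c, hc⟩ := hcover V
    rcases Fin.eq_zero_or_eq_succ c with rfl | ⟨j, rfl⟩
    · rw [if_pos hc]; linarith
    by_cases hhit : ∃ i, X i ∈ C j.succ
    · obtain ⟨i, hi⟩ := hhit
      have hD : Distorted δ R X V := by
        by_contra hD
        have h3 := (abs_le.1 (not_lt.1 fun h => hD ⟨i, h⟩)).2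
        have h4 := hdiam j.succ (Fin.succ_ne_zero j) V hc (X i) hi
        obtain ⟨i', hi'⟩ := exists_assignedTo (R := R) (x := fun i j => X i j)
          (y := fun j => V j) (δ := δ) i (by linarith)
        exact assignment_eq_none.1 hV i' hi'
      rw [if_pos hD]
      linarith
    · push Not at hhit
      have h5 := Finset.single_le_sum h1 (Finset.mem_univ j)
      rw [if_pos hc, Finset.prod_congr rfl (fun i _ => if_neg (hhit i)), Finset.prod_const_one,
        mul_one] at h5
      linarith
  have hdev := sum_abs_weight_lt hζ hw
  rw [Fintype.sum_option] at hdev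
  have h6 : (0 : ℝ) ≤ ∑ i, |empirical δ R X Y (some i) - assignProb D δ R X (some i)| :=
    Finset.sum_nonneg fun i _ => abs_nonneg _
  have h7 := le_abs_self (empirical δ R X Y none - assignProb D δ R X none)
  rw [unassigned_eq_empirical ht₂, not_lt]
  gcongr
  linarith

end Run

/-! ### The expected deviations -/

section ExpectedLoss

variable {n k t₁ t₂ : ℕ}

theorem expect_columnLoss_le (hk : 0 < k) (X : Fin t₁ → Cube n) :
    expect (uniform (IndexSet n k)) (fun R => columnLoss R.1 X) ≤ 4 ^ t₁ / k := by
  simp only [columnLoss, expect_mul_left, expect_sum]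
  calc (2 : ℝ) ^ t₁ * ∑ J, expect (uniform (IndexSet n k)) (fun R =>
        (columnFreq (R := R.1) (fun i j => X i j) J - (columnCount X J : ℝ) / n) ^ 2)
      ≤ 2 ^ t₁ * ∑ _J : Fin t₁ → Bool, 1 / (k : ℝ) := by
        gcongr with J
        exact index_variance hk fun p => (fun i => X i p) = J
    _ = 4 ^ t₁ / k := by
        rw [Finset.sum_const, Finset.card_univ, nsmul_eq_mul]
        simp only [Fintype.card_pi, Fintype.card_bool, Finset.prod_const, Finset.card_univ,
          Fintype.card_fin]
        rw [show (4 : ℝ) = 2 * 2 by norm_num, mul_pow]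
        push_cast
        ring

theorem expect_distLoss_le (hk : 0 < k) (D : Distr (Cube n)) (X : Fin t₁ → Cube n) :
    expect (uniform (IndexSet n k)) (fun R => distLoss D R.1 X) ≤ t₁ / k := by
  simp only [distLoss, expect_sum]
  calc ∑ i, expect (uniform (IndexSet n k)) (fun R => expect D fun Y =>
        (dH (fun j : {j // j ∈ R.1} => Y j) (fun j => X i j) - dH Y (X i)) ^ 2)
      ≤ ∑ _i : Fin t₁, 1 / (k : ℝ) := by
        refine Finset.sum_le_sum fun i _ => ?_
        rw [expect_comm]
        refine expect_le_of_le D fun Y => ?_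
        refine le_trans (le_of_eq ?_) (index_variance hk fun p => Y p ≠ X i p)
        simp only [dH, hammingDist, Fintype.card_coe, Fintype.card_fin]
    _ = t₁ / k := by simp [div_eq_mul_inv]

theorem expect_weightLoss_le (ht₂ : 0 < t₂) (D : Distr (Cube n)) (δ : ℝ) (R : Finset (Fin n))
    (X : Fin t₁ → Cube n) :
    expect (iid D t₂) (fun Y => weightLoss D δ R X Y) ≤ ((t₁ : ℝ) + 1) ^ 2 / t₂ := by
  simp only [weightLoss, expect_mul_left, expect_sum]
  calc ((t₁ : ℝ) + 1) * ∑ κ, expect (iid D t₂) (fun Y =>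
        (empirical δ R X Y κ - assignProb D δ R X κ) ^ 2)
      ≤ (t₁ + 1) * ∑ _κ : Option (Fin t₁), 1 / (t₂ : ℝ) := by
        gcongr with κ
        exact empirical_variance D ht₂ fun V => assignment δ R X V = κ
    _ = ((t₁ : ℝ) + 1) ^ 2 / t₂ := by
        rw [Finset.sum_const, Finset.card_univ, nsmul_eq_mul]
        simp only [Fintype.card_option, Fintype.card_fin]
        push_cast
        ring

theorem mul_one_sub_pow_le {p : ℝ} (hp0 : 0 ≤ p) (hp1 : p ≤ 1) {t : ℕ} (ht : 0 < t) :
    p * (1 - p) ^ t ≤ 1 / t := by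
  have ht' : (0 : ℝ) < t := by exact_mod_cast ht
  have h1 : 1 + t * p ≤ (1 + p) ^ t := one_add_mul_le_pow (by linarith) t
  have h2 : (1 - p) ^ t * (1 + p) ^ t ≤ 1 := by
    rw [← mul_pow]
    exact pow_le_one₀ (by nlinarith) (by nlinarith)
  have h3 : 0 ≤ (1 - p) ^ t := pow_nonneg (by linarith) t
  rw [le_div_iff₀ ht']
  nlinarith [mul_le_mul_of_nonneg_left h1 h3]

/-- A cluster of mass `p` is missed with probability `(1 - p) ^ t₁`, so that it contributes at most
`1 / t₁` to the expected missed mass, whatever `p` is. -/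
theorem expect_missedMass_le (ht₁ : 0 < t₁) (D : Distr (Cube n)) {s : ℕ}
    (C : Fin s → Finset (Cube n)) :
    expect (iid D t₁) (fun X => missedMass D C X) ≤ s / t₁ := by
  classical
  simp only [missedMass, expect_sum, expect_mul_left]
  calc ∑ j, mass D (C j) * expect (iid D t₁) (fun X => ∏ i, if X i ∈ C j then 0 else 1)
      ≤ ∑ _j : Fin s, 1 / (t₁ : ℝ) := by
        refine Finset.sum_le_sum fun j _ => ?_
        have h1 : expect D (fun V => if V ∈ C j then 1 else 0) = mass D (C j) := by
          simp [expect, mass]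
        have h2 : expect D (fun V => if V ∈ C j then 0 else 1) = 1 - mass D (C j) := by
          rw [eq_sub_iff_add_eq, ← h1, ← expect_add]
          refine (congrArg _ ?_).trans (expect_const D 1)
          funext V
          split_ifs <;> norm_num
        rw [expect_iid_prod D t₁ fun _ V => if V ∈ C j then 0 else 1, Finset.prod_const, h2,
          Finset.card_univ, Fintype.card_fin]
        refine mul_one_sub_pow_le ?_ ?_ ht₁
        · rw [← h1]; exact expect_indicator_nonneg D _
        · rw [← h1]; exact expect_indicator_le_one D _
    _ = s / t₁ := by simp [div_eq_mul_inv]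

end ExpectedLoss

/-! ### The probability of a bad run -/

section Probability

variable {n k t₁ t₂ : ℕ} {ζ δ : ℝ}

open Classical in
theorem prob_testAndLearn (I : Implementation n t₁ t₂ k ζ δ) (D : Distr (Cube n))
    (E : Option (Distr (Cube n)) → Prop) :
    (testAndLearn I).prob D E =
      expect (uniform (IndexSet n k)) fun R => expect (iid D t₁) fun X => expect (iid D t₂) fun Y =>
        if E (I.out R fun i j => Fin.append X Y i j) then 1 else 0 := by
  have h : ∀ R : IndexSet n k, (expect (iid D t₁) fun X => expect (iid D t₂) fun Y =>
      if E (I.out R fun i j => Fin.append X Y i j) then 1 else 0) =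
      expect (iid D (t₁ + t₂)) fun V => if E (I.out R fun i j => V i j) then 1 else 0 :=
    fun R => (expect_iid_append D t₁ t₂
      (fun V => if E (I.out R fun i j => V i j) then 1 else 0)).symm
  simp only [h]
  simp only [expect, Finset.mul_sum]
  refine Finset.sum_congr rfl fun R _ => Finset.sum_congr rfl fun V _ => ?_
  rw [iid_apply]
  change (if E (I.out R fun i j => V i j) then _ else _) = _
  split_ifs
  · rw [mul_one]; rfl
  · simp

theorem prob_add_prob_not (I : Implementation n t₁ t₂ k ζ δ) (D : Distr (Cube n))
    (E : Option (Distr (Cube n)) → Prop) :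
    (testAndLearn I).prob D E + (testAndLearn I).prob D (fun o => ¬ E o) = 1 := by
  classical
  simp only [prob_testAndLearn, ← expect_add]
  refine (congrArg _ ?_).trans (expect_const (uniform (IndexSet n k)) 1)
  funext R
  refine (congrArg _ ?_).trans (expect_const (iid D t₁) 1)
  funext X
  refine (congrArg _ ?_).trans (expect_const (iid D t₂) 1)
  funext Y
  split_ifs <;> norm_num

theorem columnLoss_nonneg (R : Finset (Fin n)) (X : Fin t₁ → Cube n) : 0 ≤ columnLoss R X := by
  unfold columnLoss; positivity

theorem distLoss_nonneg (D : Distr (Cube n)) (R : Finset (Fin n)) (X : Fin t₁ → Cube n) :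
    0 ≤ distLoss D R X :=
  Finset.sum_nonneg fun _ _ => expect_nonneg D fun _ => sq_nonneg _

theorem weightLoss_nonneg (D : Distr (Cube n)) (δ : ℝ) (R : Finset (Fin n))
    (X : Fin t₁ → Cube n) (Y : Fin t₂ → Cube n) : 0 ≤ weightLoss D δ R X Y := by
  unfold weightLoss; positivity

theorem missedMass_nonneg (D : Distr (Cube n)) {s : ℕ} (C : Fin s → Finset (Cube n))
    (X : Fin t₁ → Cube n) : 0 ≤ missedMass D C X :=
  Finset.sum_nonneg fun j _ => mul_nonneg (Finset.sum_nonneg fun V _ => distr_nonneg D V)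
    (Finset.prod_nonneg fun i _ => by split_ifs <;> norm_num)

/-- Markov's inequality for the sum of the normalized deviations. An event that occurs only if
one of the deviations is large has probability at most `1/3`; here `M` is a further quantity that
depends on the centers only. -/
theorem prob_le_third (hζ : 0 < ζ) (hδ : 0 < δ) (hk : 0 < k) (ht₂ : 0 < t₂)
    (h₁ : (4 : ℝ) ^ t₁ / k ≤ δ ^ 2 / 12) (h₂ : (t₁ : ℝ) / k ≤ δ ^ 2 * (ζ / 2) / 12)
    (h₃ : ((t₁ : ℝ) + 1) ^ 2 / t₂ ≤ ζ ^ 2 / 12)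
    (I : Implementation n t₁ t₂ k ζ δ) (D : Distr (Cube n)) (E : Option (Distr (Cube n)) → Prop)
    (M : (Fin t₁ → Cube n) → ℝ) (hM0 : ∀ X, 0 ≤ M X) (hM : expect (iid D t₁) M ≤ ζ / 2 / 12)
    (hE : ∀ (R : IndexSet n k) (X : Fin t₁ → Cube n) (Y : Fin t₂ → Cube n),
      columnLoss R.1 X < δ ^ 2 → distLoss D R.1 X < δ ^ 2 * (ζ / 2) →
      weightLoss D δ R.1 X Y < ζ ^ 2 → M X < ζ / 2 →
      ¬ E (I.out R fun i j => Fin.append X Y i j)) :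
    (testAndLearn I).prob D E ≤ 1 / 3 := by
  classical
  rw [prob_testAndLearn]
  have hlt : ∀ {a c : ℝ}, 0 < c → c⁻¹ * a < 1 → a < c := fun hc h => by
    rwa [inv_mul_lt_iff₀ hc, mul_one] at h
  have hle : ∀ {a c : ℝ}, 0 < c → a ≤ c / 12 → c⁻¹ * a ≤ 1 / 12 := fun hc h => by
    rw [inv_mul_le_iff₀ hc]; linarith
  have hδ2 : 0 < δ ^ 2 := by positivity
  have hδζ : 0 < δ ^ 2 * (ζ / 2) := by positivity
  have hζ2 : 0 < ζ ^ 2 := by positivity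
  have hζh : 0 < ζ / 2 := by positivity
  have hpt : ∀ (R : IndexSet n k) (X : Fin t₁ → Cube n) (Y : Fin t₂ → Cube n),
      (if E (I.out R fun i j => Fin.append X Y i j) then (1 : ℝ) else 0) ≤
        (δ ^ 2)⁻¹ * columnLoss R.1 X + (δ ^ 2 * (ζ / 2))⁻¹ * distLoss D R.1 X +
          (ζ / 2)⁻¹ * M X + (ζ ^ 2)⁻¹ * weightLoss D δ R.1 X Y := by
    intro R X Y
    have a1 := mul_nonneg (inv_nonneg.2 hδ2.le) (columnLoss_nonneg R.1 X)
    have a2 := mul_nonneg (inv_nonneg.2 hδζ.le) (distLoss_nonneg D R.1 X)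
    have a3 := mul_nonneg (inv_nonneg.2 hζh.le) (hM0 X)
    have a4 := mul_nonneg (inv_nonneg.2 hζ2.le) (weightLoss_nonneg D δ R.1 X Y)
    split_ifs with h
    · by_contra hcon
      exact hE R X Y (hlt hδ2 (by linarith)) (hlt hδζ (by linarith)) (hlt hζ2 (by linarith))
        (hlt hζh (by linarith)) h
    · positivity
  calc _ ≤ expect (uniform (IndexSet n k)) (fun R => expect (iid D t₁) fun X =>
        expect (iid D t₂) fun Y => (δ ^ 2)⁻¹ * columnLoss R.1 X +
          (δ ^ 2 * (ζ / 2))⁻¹ * distLoss D R.1 X +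
          (ζ / 2)⁻¹ * M X + (ζ ^ 2)⁻¹ * weightLoss D δ R.1 X Y) :=
        expect_mono _ fun R => expect_mono _ fun X => expect_mono _ fun Y => hpt R X Y
    _ ≤ expect (uniform (IndexSet n k)) (fun R => expect (iid D t₁) fun X =>
        (δ ^ 2)⁻¹ * columnLoss R.1 X + (δ ^ 2 * (ζ / 2))⁻¹ * distLoss D R.1 X +
          (ζ / 2)⁻¹ * M X + 1 / 12) := by
        refine expect_mono _ fun R => expect_mono _ fun X => ?_
        rw [expect_add, expect_const, expect_mul_left]
        gcongr
        exact hle hζ2 ((expect_weightLoss_le ht₂ D δ R.1 X).trans h₃)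
    _ = expect (iid D t₁) (fun X => expect (uniform (IndexSet n k)) fun R =>
        (δ ^ 2)⁻¹ * columnLoss R.1 X + (δ ^ 2 * (ζ / 2))⁻¹ * distLoss D R.1 X +
          (ζ / 2)⁻¹ * M X + 1 / 12) := expect_comm _ _ _
    _ ≤ expect (iid D t₁) (fun X => (ζ / 2)⁻¹ * M X + 1 / 4) := by
        refine expect_mono _ fun X => ?_
        simp only [expect_add, expect_const, expect_mul_left]
        have b1 := hle hδ2 ((expect_columnLoss_le (k := k) hk X).trans h₁)
        have b2 := hle hδζ ((expect_distLoss_le (k := k) hk D X).trans h₂)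
        linarith
    _ ≤ 1 / 3 := by
        rw [expect_add, expect_const, expect_mul_left]
        linarith [hle hζh hM]

end Probability

/-! ### The sample sizes -/

section Sizes

variable {ζ δ : ℝ} {r t₁ t₂ k : ℕ}

theorem one_le_log {x : ℝ} (hx : 3 ≤ x) : 1 ≤ Real.log x := by
  rw [Real.le_log_iff_exp_le (by linarith)]
  linarith [Real.exp_one_lt_d9]

theorem le_sizeS (hζ : 0 < ζ) (h3 : 3 * ζ ≤ r) :
    24 * (r / ζ) ≤ sizeS 24 ζ r := by
  refine le_trans ?_ (Nat.le_ceil _)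
  have h : 3 ≤ (r : ℝ) / ζ := by rwa [le_div_iff₀ hζ]
  exact le_mul_of_one_le_right (by linarith) (one_le_log h)

theorem le_sizeT (h3 : 3 ≤ t₁) : 48 * ((t₁ : ℝ) ^ 2 / ζ ^ 2) ≤ sizeT 48 ζ t₁ := by
  refine le_trans ?_ (Nat.le_ceil _)
  exact le_mul_of_one_le_right (by positivity) (one_le_log (by exact_mod_cast h3))

theorem le_sizeR (hζ : 0 < ζ) (hδ : 0 < δ) (h3 : 3 * (δ * ζ) ≤ r) :
    24 * ((4 : ℝ) ^ t₁ / (δ ^ 2 * ζ)) ≤ sizeR 24 ζ δ r t₁ := by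
  refine le_trans ?_ (Nat.le_ceil _)
  exact le_mul_of_one_le_right (by positivity)
    (one_le_log (by rwa [le_div_iff₀ (by positivity)]))

end Sizes

end HugeObject

open HugeObject
theorem theorem3p2 :
    ∃ c₁ c₂ c₃ : ℝ, 0 < c₁ ∧ 0 < c₂ ∧ 0 < c₃ ∧
      ∀ (ζ δ : ℝ) (r t₁ t₂ k : ℕ), 0 < ζ → ζ < 1 → 0 < δ → δ < 1 → 17 * (δ + ζ) < 1 → 1 ≤ r →
        t₁ = sizeS c₁ ζ r → t₂ = sizeT c₂ ζ t₁ → k = sizeR c₃ ζ δ r t₁ →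
        ∀ n : ℕ,
          Nonempty (Implementation n t₁ t₂ k ζ δ) ∧
          ∀ I : Implementation n t₁ t₂ k ζ δ,
            (∀ c, (testAndLearn I).queryCount c ≤ (t₁ + t₂) * k) ∧
            ∀ D : Distr (Cube n),
              (Clusterable ζ δ r D →
                2 / 3 ≤ (testAndLearn I).prob D (fun o => ∃ D', o = some D' ∧
                  ∃ σ : Equiv.Perm (Fin n), dEM D (permute D' σ) ≤ 17 * (δ + ζ))) ∧
              (testAndLearn I).prob D (fun o => ∃ D', o = some D' ∧
                ∀ σ : Equiv.Perm (Fin n), 17 * (δ + ζ) < dEM D (permute D' σ)) ≤ 1 / 3 := by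
  refine ⟨24, 48, 24, by norm_num, by norm_num, by norm_num, ?_⟩
  intro ζ δ r t₁ t₂ k hζ hζ1 hδ hδ1 hε hr ht₁ ht₂ hk n
  have hr' : (1 : ℝ) ≤ r := by exact_mod_cast hr
  have s1 : 24 * (r / ζ) ≤ (t₁ : ℝ) := ht₁ ▸ le_sizeS hζ (by linarith)
  have hq : 1 ≤ (r : ℝ) / ζ := by rw [le_div_iff₀ hζ]; linarith
  have ht₁3 : 3 ≤ t₁ := by
    have : (3 : ℝ) ≤ t₁ := by linarith
    exact_mod_cast this
  have s2 : 48 * ((t₁ : ℝ) ^ 2 / ζ ^ 2) ≤ (t₂ : ℝ) := ht₂ ▸ le_sizeT ht₁3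
  have s3 : 24 * ((4 : ℝ) ^ t₁ / (δ ^ 2 * ζ)) ≤ (k : ℝ) :=
    hk ▸ le_sizeR hζ hδ (by nlinarith)
  clear ht₁ ht₂ hk
  have ht₁' : (3 : ℝ) ≤ t₁ := by exact_mod_cast ht₁3
  have ht₁0 : (0 : ℝ) < t₁ := by linarith
  have ht₂0 : (0 : ℝ) < t₂ := lt_of_lt_of_le (by positivity) s2
  have hk0 : (0 : ℝ) < k := lt_of_lt_of_le (by positivity) s3
  have ht₂n : 0 < t₂ := by exact_mod_cast ht₂0
  have hkn : 0 < k := by exact_mod_cast hk0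
  have ht₁n : 0 < t₁ := by omega
  rw [← mul_div_assoc, div_le_iff₀ hζ] at s1
  rw [← mul_div_assoc, div_le_iff₀ (by positivity)] at s2 s3
  have hδ2 : 0 < δ ^ 2 := by positivity
  have h₁ : (4 : ℝ) ^ t₁ / k ≤ δ ^ 2 / 12 := by
    rw [div_le_iff₀ hk0]
    have : (k : ℝ) * (δ ^ 2 * ζ) ≤ k * (δ ^ 2 * 1) := by gcongr
    have : (0 : ℝ) < k * δ ^ 2 := by positivity
    linarith
  have h₂ : (t₁ : ℝ) / k ≤ δ ^ 2 * (ζ / 2) / 12 := by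
    rw [div_le_iff₀ hk0]
    have : (t₁ : ℝ) ≤ 4 ^ t₁ := by
      exact_mod_cast (Nat.lt_pow_self (by norm_num : 1 < 4)).le
    linarith
  have h₃ : ((t₁ : ℝ) + 1) ^ 2 / t₂ ≤ ζ ^ 2 / 12 := by
    rw [div_le_iff₀ ht₂0]
    nlinarith
  have h2k : (2 : ℝ) ^ t₁ ≤ δ * k := by
    have e1 : (2 : ℝ) ^ t₁ ≤ 4 ^ t₁ := by gcongr; norm_num
    have e2 : (k : ℝ) * (δ ^ 2 * ζ) ≤ k * (δ * 1) := by
      gcongr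
      nlinarith
    have e3 : (0 : ℝ) < 4 ^ t₁ := by positivity
    linarith
  refine ⟨nonempty_implementation n t₁ t₂ k ζ δ ht₁n hkn, fun I => ⟨fun c => ?_, fun D => ⟨?_, ?_⟩⟩⟩
  · have hc : c.1.card ≤ k := c.2.trans_le (min_le_left _ _)
    simp only [NonAdaptiveAlgorithm.queryCount, testAndLearn, Finset.sum_const, Finset.card_univ,
      Fintype.card_fin, smul_eq_mul]
    gcongr
  · rintro ⟨s, hs, C, -, hcover, hzero, hdiam⟩
    have hs' : (s : ℝ) ≤ r := by exact_mod_cast hs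
    have hbad := prob_le_third hζ hδ hkn ht₂n h₁ h₂ h₃ I D (fun o => ¬ ∃ D', o = some D' ∧
      ∃ σ : Equiv.Perm (Fin n), dEM D (permute D' σ) ≤ 17 * (δ + ζ))
      (missedMass D fun j => C j.succ) (missedMass_nonneg D _)
      ((expect_missedMass_le ht₁n D _).trans (by rw [div_le_iff₀ ht₁0]; linarith))
      (fun R X Y g1 g2 g3 g4 => by
        have hspec := I.out_spec R fun i j => Fin.append X Y i j
        simp only [Fin.append_left, Fin.append_right] at hspec
        have hnf := not_fail_of_small_loss hζ hδ ht₂n hcover hzero hdiam g2 g3 g4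
        rw [not_not]
        rcases hspec with ⟨hf, -⟩ | ⟨hf, S, hS, D', hD', hrest⟩
        · exact absurd hf hnf
        · exact ⟨D', hD', exists_perm_dEM_le hζ hδ h2k ht₂n R.2 g1 g2 g3
            (Or.inr ⟨hf, S, hS, D', rfl, hrest⟩)⟩)
    linarith [prob_add_prob_not I D (fun o => ∃ D', o = some D' ∧
      ∃ σ : Equiv.Perm (Fin n), dEM D (permute D' σ) ≤ 17 * (δ + ζ))]
  · refine prob_le_third hζ hδ hkn ht₂n h₁ h₂ h₃ I D _ (fun _ => 0) (fun _ => le_rfl)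
      (by rw [expect_const]; positivity) ?_
    rintro R X Y g1 g2 g3 - ⟨D', hD', hfar⟩
    have hspec := I.out_spec R fun i j => Fin.append X Y i j
    simp only [Fin.append_left, Fin.append_right] at hspec
    rw [hD'] at hspec
    obtain ⟨σ, hσ⟩ := exists_perm_dEM_le hζ hδ h2k ht₂n R.2 g1 g2 g3 hspec
    exact absurd hσ (not_le.2 (hfar σ))
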